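/- Let $k$ be an algebraically closed field containing $\mathbb{R}$, $F=k((z))$, $\mathfrak{o}=k[[z]]$, $\tau=z\frac{d}{dz}$, and let $(U,\nabla)$ be a formal flat vector bundle: a finite-dimensional $F$-vector space $U$ with a connection $\nabla:U\to\Omega^1(U)=U\frac{dz}{z}$, that is, $\nabla u=\nabla_\tau(u)\frac{dz}{z}$ with $\nabla_\tau:U\to U$ $k$-linear and $\nabla_\tau(fu)=\tau(f)u+f\nabla_\tau(u)$ for $f\in F$, $u\in U$. *Regular singularity and slope.* $(U,\nabla)$ is regular singular if $\nabla_\tau(L)\subseteq L$ for some $\mathfrak{o}$-lattice $L\subset U$; its slope is then $0$. Otherwise it is irregular singular, and its slope is the positive rational number $t$ such that $\{v(\nabla_\tau^i\mathbf{e})+ti\mid i>0\}$ is bounded, where $\mathbf{e}$ is a basis of $U$, $L$ is an $\mathfrak o$-lattice in $U$, $\nabla_\tau^i\mathbf e=\{\nabla_\tau^i e_j\}_j$, and $v(\mathbf{e}')$ is the greatest integer $m$ with $\mathbf{e}'\subset z^mL$. *Points of the building.* A point $x$ of the (enlarged) Bruhat--Tits building of $\mathrm{GL}(U)$ is identified with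 its periodic filtration $\{U_{x,r}\}_{r\in\mathbb{R}}$ of $U$ by $\mathfrak{o}$-lattices. These are the filtrations for which there are a basis $b_1,\dots,b_n$ of $U$ and real numbers $a_1,\dots,a_n$ such that $U_{x,r}$ is, for every $r$, the set of vectors $\sum_i f_ib_i$ in which $f_i\in F$ only involves powers $z^m$ with $a_i+m\ge r$. Put $\mathfrak{gl}(U)=\mathrm{End}_F(U)$, $\mathfrak{gl}(U)_{x,r}=\{Y\mid Y(U_{x,s})\subseteq U_{x,s+r}\ \forall s\in\mathbb{R}\}$, $U_{x,r+}=\bigcup_{s>r}U_{x,s}$ and $\mathfrak{gl}(U)_{x,r+}=\bigcup_{s>r}\mathfrak{gl}(U)_{x,s}$. *Strata.* A $U$-stratum of depth $r$ is a triple $(x,r,\beta)$ with $x$ a point of the building, $r\ge0$ a real number, and $\beta$ a $k$-linear functional on $\mathfrak{gl}(U)_{x,r}/\mathfrak{gl}(U)_{x,r+}$. An element $Y\in\mathfrak{gl}(U)_{x,-r}$ represents $\beta$ if $\beta$ is induced by $Z\mapsto\mathrm{Res}\,\mathrm{Tr}(YZ)\frac{dz}{z}$. The stratum is fundamental if every representative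 of $\beta$ is non-nilpotent. It is contained in $(U,\nabla)$ if for some (equivalently, any) representative $Y$ of $\beta$, $$(\nabla_\tau-j-Y)(U_{x,j})\subseteq U_{x,(j-r)+}\qquad\text{for all }j\in\mathbb{R}.$$ **Proposition.** The slope of $(U,\nabla)$ is well defined: exactly one rational number is the slope, and it does not depend on the choice of $L$ and $\mathbf{e}$. Moreover: 1. the slope of $(U,\nabla)$ is the minimum of the depths of the strata contained in $(U,\nabla)$; 2. if a stratum $(x,r,\beta)$ contained in $(U,\nabla)$ is fundamental, then $r$ is equal to the slope of $(U,\nabla)$; 3. conversely, if a stratum $(x,r,\beta)$ contained in $(U,\nabla)$ has $r>0$ and $r$ is equal to the slope of $(U,\nabla)$, then $(x,r,\beta)$ is fundamental; 4. in particular, $(U,\nabla)$ is regular singular if and only if it contains a stratum of depth $0$. -/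

import Mathlib

open LaurentSeries PowerSeries

universe u v

set_option linter.unusedSectionVars false

noncomputable section

namespace FormalConnection

/-- The Euler vector field `τ = z d/dz` acting on the field `F = k((z))`. -/
def euler {k : Type u} [Field k] (f : k⸨X⸩) : k⸨X⸩ :=
  HahnSeries.single (1 : ℤ) (1 : k) * LaurentSeries.derivative k f

theorem euler_coeff {k : Type u} [Field k] (f : k⸨X⸩) (n : ℤ) :
    (euler f).coeff n = (n : k) * f.coeff n := by
  have h := HahnSeries.coeff_single_mul_add (r := (1 : k))
    (x := LaurentSeries.derivative k f) (a := n - 1) (b := (1 : ℤ))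
  rw [sub_add_cancel] at h
  rw [euler, h, LaurentSeries.derivative_apply, LaurentSeries.hasseDeriv_coeff]
  simp

section Definitions

variable (k : Type u) [Field k]
variable (U : Type v) [AddCommGroup U] [Module k⸨X⸩ U] [Module k⟦X⟧ U] [IsScalarTower k⟦X⟧ k⸨X⸩ U]
  [Module k U] [IsScalarTower k k⸨X⸩ U]

/-- A connection `∇ : U → Ω¹(U)` on the `F`-vector space `U`.  As `Ω¹(U) = U dz/z`, one has
`∇ u = (∇_τ u) dz/z` with `∇_τ = ι_τ ∘ ∇ : U → U`, and `∇` is recorded through `∇_τ`, a `k`-linear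
operator satisfying the Leibniz rule for `τ = z d/dz`. -/
structure Connection where
  /-- The operator `∇_τ = ι_τ ∘ ∇`. -/
  op : U →ₗ[k] U
  leibniz : ∀ (f : k⸨X⸩) (u : U), op (f • u) = euler f • u + f • op u

/-- A point `x` of the (enlarged) Bruhat–Tits building of `GL(U)`, given by its periodic filtration
`{U_{x,r}}` by `𝔬`-lattices.  The apartment of a basis `b` consists of the points `a ∈ ℝⁿ`; the line
`k z^m b_i` is homogeneous of degree `a_i + m`, and `U_{x,r}` is the set of vectors all of whose
homogeneous components have degree at least `r`.  The building is the union of the apartments. -/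
structure BuildingPoint where
  /-- The lattice `U_{x,r}`. -/
  filt : ℝ → Submodule k⟦X⟧ U
  exists_apartment : ∃ (b : Module.Basis (Fin (Module.finrank k⸨X⸩ U)) k⸨X⸩ U)
    (a : Fin (Module.finrank k⸨X⸩ U) → ℝ),
    ∀ (r : ℝ) (u : U), u ∈ filt r ↔
      ∀ (i : Fin (Module.finrank k⸨X⸩ U)) (m : ℤ), a i + (m : ℝ) < r → (b.repr u i).coeff m = 0

variable {k U}

theorem C_smul (c : k) (u : U) : (HahnSeries.C c : k⸨X⸩) • u = c • u := by
  rw [← mul_one (HahnSeries.C c : k⸨X⸩), HahnSeries.C_mul_eq_smul, smul_assoc, one_smul]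

instance instSMulCommClass : SMulCommClass k⸨X⸩ k U where
  smul_comm f c u := by
    rw [← C_smul (k := k) c u, ← C_smul (k := k) c (f • u), smul_smul, smul_smul, mul_comm]

namespace BuildingPoint

variable (x : BuildingPoint k U)

theorem filt_antitone : Antitone x.filt := by
  obtain ⟨b, a, h⟩ := x.exists_apartment
  intro r s hrs u hu
  rw [h] at hu ⊢
  exact fun i m hm => hu i m (lt_of_lt_of_le hm hrs)

theorem smul_mem_filt (c : k) {r : ℝ} {u : U} (hu : u ∈ x.filt r) : c • u ∈ x.filt r := by
  obtain ⟨b, a, h⟩ := x.exists_apartment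
  rw [h] at hu ⊢
  intro i m hm
  rw [← C_smul, map_smul, Finsupp.smul_apply, smul_eq_mul, HahnSeries.C_mul_eq_smul,
    HahnSeries.coeff_smul, hu i m hm, smul_zero]

/-- The next step `U_{x,r+} = ⋃_{s > r} U_{x,s}`. -/
def filtPlus (r : ℝ) : Submodule k⟦X⟧ U where
  carrier := {u | ∃ s : ℝ, r < s ∧ u ∈ x.filt s}
  add_mem' := by
    rintro u w ⟨s, hs, hu⟩ ⟨t, ht, hw⟩
    exact ⟨min s t, lt_min hs ht, add_mem (x.filt_antitone (min_le_left s t) hu)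
      (x.filt_antitone (min_le_right s t) hw)⟩
  zero_mem' := ⟨r + 1, by linarith, zero_mem _⟩
  smul_mem' := by
    rintro f u ⟨s, hs, hu⟩
    exact ⟨s, hs, Submodule.smul_mem _ f hu⟩

/-- The induced filtration `𝔤𝔩(U)_{x,r} = {Y | Y(U_{x,s}) ⊆ U_{x,s+r} for all s}` on the
`F`-linear endomorphisms of `U`. -/
def gl (r : ℝ) : Submodule k (Module.End k⸨X⸩ U) where
  carrier := {Y | ∀ s : ℝ, ∀ u ∈ x.filt s, Y u ∈ x.filt (s + r)}
  add_mem' := fun hY hZ s u hu => add_mem (hY s u hu) (hZ s u hu)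
  zero_mem' := fun _ _ _ => zero_mem _
  smul_mem' := fun c _ hY s u hu => x.smul_mem_filt c (hY s u hu)

theorem gl_antitone : Antitone x.gl := fun _ _ hrs _ hY s u hu =>
  x.filt_antitone (by linarith) (hY s u hu)

/-- The next step `𝔤𝔩(U)_{x,r+} = ⋃_{s > r} 𝔤𝔩(U)_{x,s}`. -/
def glPlus (r : ℝ) : Submodule k (Module.End k⸨X⸩ U) where
  carrier := {Y | ∃ s : ℝ, r < s ∧ Y ∈ x.gl s}
  add_mem' := by
    rintro Y Z ⟨s, hs, hY⟩ ⟨t, ht, hZ⟩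
    exact ⟨min s t, lt_min hs ht, add_mem (x.gl_antitone (min_le_left s t) hY)
      (x.gl_antitone (min_le_right s t) hZ)⟩
  zero_mem' := ⟨r + 1, by linarith, zero_mem _⟩
  smul_mem' := by
    rintro c Y ⟨s, hs, hY⟩
    exact ⟨s, hs, Submodule.smul_mem _ c hY⟩

end BuildingPoint

variable (k U) in
/-- A `U`-stratum `(x, r, β)`: a point `x` of the building of `GL(U)`, a real depth `r ≥ 0` and a
`k`-linear functional `β` on `𝔤𝔩(U)_{x,r} / 𝔤𝔩(U)_{x,r+}`. -/
structure Stratum where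
  point : BuildingPoint k U
  depth : ℝ
  depth_nonneg : 0 ≤ depth
  functional : Module.Dual k
    (↥(point.gl depth) ⧸ (point.glPlus depth).submoduleOf (point.gl depth))

namespace Stratum

variable (S : Stratum k U)

/-- `Y ∈ 𝔤𝔩(U)_{x,-r}` represents `β` if `β` is induced by `Z ↦ Res Tr(Y Z) dz/z`.  Here
`𝔤𝔩(U)` is identified with its `F`-dual by the trace form, and the residue of `f dz/z` is the
coefficient of `z^0` in `f`.  The associated one-form `X_β` is `Y dz/z`. -/
def IsRepresentative (Y : Module.End k⸨X⸩ U) : Prop :=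
  Y ∈ S.point.gl (-S.depth) ∧
    ∀ Z : ↥(S.point.gl S.depth),
      S.functional (Submodule.Quotient.mk Z) =
        (LinearMap.trace k⸨X⸩ U (Y * (Z : Module.End k⸨X⸩ U))).coeff 0

/-- A stratum is fundamental if all its representatives are non-nilpotent. -/
def IsFundamental : Prop :=
  ∀ Y : Module.End k⸨X⸩ U, S.IsRepresentative Y → ¬ IsNilpotent Y

end Stratum

/-- The family `e` is contained in `z^m L`. -/
def InShiftedLattice {ι : Type*} (L : Submodule k⟦X⟧ U) (m : ℤ) (e : ι → U) : Prop :=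
  ∀ j, ∃ w ∈ L, e j = (HahnSeries.single m (1 : k) : k⸨X⸩) • w

namespace Connection

variable (D : Connection k U)

/-- `∇` is regular singular if `∇_τ` preserves some `𝔬`-lattice of `U`. -/
def IsRegularSingular : Prop :=
  ∃ L : Submodule k⟦X⟧ U, L.IsLattice k⸨X⸩ ∧ ∀ u ∈ L, D.op u ∈ L

/-- `t` is the slope of `∇`, as computed from the lattice `L` and the basis `e`.  Writing `v(e')` for
the greatest `m` with `e' ⊆ z^m L`, this means: `t = 0` if `∇` is regular singular; otherwise `t` is
positive and the set of the numbers `v(∇_τ^i e) + t i`, `i > 0`, is bounded. -/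
def HasSlope {ι : Type*} (L : Submodule k⟦X⟧ U) (e : Module.Basis ι k⸨X⸩ U) (t : ℚ) : Prop :=
  (D.IsRegularSingular ∧ t = 0) ∨
    (¬ D.IsRegularSingular ∧ 0 < t ∧ ∃ C : ℚ, ∀ i : ℕ, 0 < i → ∃ m : ℤ,
      IsGreatest {m : ℤ | InShiftedLattice L m (fun j => (D.op ^ i) (e j))} m ∧
        |(m : ℚ) + t * (i : ℚ)| ≤ C)

/-- `(U, ∇)` contains the stratum `(x, r, β)`: for a representative `Y dz/z` of `β`,
`(∇ - j dz/z - Y dz/z) U_{x,j} ⊆ Ω¹(U)_{x,(j-r)+}` for all real `j`, where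
`Ω¹(U)_{x,s} = U_{x,s} dz/z`.  (The condition does not depend on the representative.) -/
def Contains [Algebra ℝ k] (S : Stratum k U) : Prop :=
  ∃ Y : Module.End k⸨X⸩ U, S.IsRepresentative Y ∧
    ∀ j : ℝ, ∀ u ∈ S.point.filt j,
      D.op u - algebraMap ℝ k j • u - Y u ∈ S.point.filtPlus (j - S.depth)

end Connection


end Definitions

end FormalConnection

end

noncomputable section

namespace FormalConnection

/-! The slope is the rate at which iterates of `∇_τ` lose degree. A point of the building, in an
apartment with basis b and coordinates a, gives z^m b_i the degree a_i + m. If `∇_τ` lowers degrees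
by at most r > 0, its homogeneous part of degree -r is F-linear, because the Leibniz term τ(f)u
loses no degree. If this leading part is not nilpotent, its powers never vanish and `∇_τ^i` loses ri
up to a bounded error (`LowersBy.exists_forall_pow_notMem`). If it is nilpotent, a fixed power of
`∇_τ` does better by some ε > 0 and the rate drops below r (`LowersBy.exists_lt_forall_pow_mem`).
Changing the point, lattice or basis shifts degrees by bounded amounts, so rates found at different
points can be compared.

A contained stratum of depth r forces `∇_τ` to lower degrees by at most r at its point, and
conversely such a bound produces a contained stratum. For r > 0 the representatives of β form the
coset of the leading part modulo higher degree, so the stratum is fundamental exactly when the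
leading part is not nilpotent (`Contains.isFundamental_iff`). Hence a fundamental depth is the rate,
which bounds all other depths from below, and a positive minimal depth forces non-nilpotency.

It remains to find one good point (`exists_lowersBy`). In the basis e, `∇_τ e`, … of a cyclic
vector, let s be the greatest Newton slope of the coefficients of `∇_τ^n e`. If s > 0, placing
`∇_τ^i e` in degree -si makes the leading part a companion matrix with a nonzero coefficient; if no
slope is positive, `∇_τ` preserves a lattice and the slope is 0. -/

theorem exists_pos_forall_le {ι : Type*} [Finite ι] {g : ι → ℝ} (hg : ∀ i, 0 < g i) :
    ∃ ε : ℝ, 0 < ε ∧ ∀ i, ε ≤ g i := by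
  have h : ∀ᶠ ε in nhdsWithin (0 : ℝ) (Set.Ioi 0), 0 < ε ∧ ∀ i, ε ≤ g i :=
    Filter.Eventually.and self_mem_nhdsWithin <| Filter.eventually_all.2 fun i =>
      nhdsWithin_le_nhds (eventually_le_nhds (hg i))
  exact h.exists

/-! ### Degree estimates for Laurent series -/

section Laurent

variable {k : Type u} [Field k]

/-- All coefficients of `f` in degrees below the real number `c` vanish. -/
def VanishBelow (f : k⸨X⸩) (c : ℝ) : Prop := ∀ m : ℤ, (m : ℝ) < c → f.coeff m = 0

namespace VanishBelow

theorem zero (c : ℝ) : VanishBelow (0 : k⸨X⸩) c := fun _ _ => rfl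

theorem mono {f : k⸨X⸩} {c d : ℝ} (hf : VanishBelow f c) (h : d ≤ c) : VanishBelow f d :=
  fun m hm => hf m (hm.trans_le h)

theorem add {f g : k⸨X⸩} {c : ℝ} (hf : VanishBelow f c) (hg : VanishBelow g c) :
    VanishBelow (f + g) c := fun m hm => by
  rw [HahnSeries.coeff_add, hf m hm, hg m hm, add_zero]

theorem mul {f g : k⸨X⸩} {c d : ℝ} (hf : VanishBelow f c) (hg : VanishBelow g d) :
    VanishBelow (f * g) (c + d) := fun m hm => by
  rw [HahnSeries.coeff_mul]
  refine Finset.sum_eq_zero fun p hp => ?_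
  have hp' : p.1 + p.2 = m := (Finset.mem_antidiagonal.1 hp).2.2
  have hp'' : (p.1 : ℝ) + p.2 = m := by exact_mod_cast hp'
  rcases lt_or_ge (p.1 : ℝ) c with h | h
  · rw [hf _ h, zero_mul]
  · rw [hg p.2 (by linarith), mul_zero]

theorem euler {f : k⸨X⸩} {c : ℝ} (hf : VanishBelow f c) : VanishBelow (euler f) c :=
  fun m hm => by rw [euler_coeff, hf m hm, mul_zero]

theorem single (m : ℤ) (r : k) : VanishBelow (HahnSeries.single m r) (m : ℝ) := fun l hl =>
  HahnSeries.coeff_single_of_ne (by rintro rfl; exact lt_irrefl _ hl)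

theorem ofPowerSeries (f : k⟦X⟧) : VanishBelow (algebraMap k⟦X⟧ k⸨X⸩ f) 0 := fun m hm => by
  have hm' : m < 0 := by exact_mod_cast hm
  change (HahnSeries.ofPowerSeries ℤ k f).coeff m = 0
  have := PowerSeries.coeff_coe f m
  rw [if_pos hm'] at this
  exact this

theorem exists_of (f : k⸨X⸩) : ∃ c : ℝ, VanishBelow f c :=
  ⟨f.order, fun m hm => HahnSeries.coeff_eq_zero_of_lt_order (by exact_mod_cast hm)⟩

theorem exists_powerSeries {f : k⸨X⸩} (hf : VanishBelow f 0) :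
    ∃ g : k⟦X⟧, algebraMap k⟦X⟧ k⸨X⸩ g = f := by
  refine ⟨PowerSeries.mk fun n => f.coeff n, ?_⟩
  change HahnSeries.ofPowerSeries ℤ k _ = f
  ext m
  have := PowerSeries.coeff_coe (PowerSeries.mk fun n => f.coeff n) m
  refine this.trans ?_
  split_ifs with h
  · exact (hf m (by exact_mod_cast h)).symm
  · rw [PowerSeries.coeff_mk, Int.natAbs_of_nonneg (not_lt.1 h)]

end VanishBelow

/-- The part of `f` in the real degree `c`, which is `0` unless `c` is an integer. -/
def degreePart (c : ℝ) (f : k⸨X⸩) : k⸨X⸩ :=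
  if ((⌊c⌋ : ℤ) : ℝ) = c then HahnSeries.single ⌊c⌋ (f.coeff ⌊c⌋) else 0

theorem degreePart_coeff_of_eq {c : ℝ} {m : ℤ} (h : (m : ℝ) = c) (f : k⸨X⸩) :
    (degreePart c f).coeff m = f.coeff m := by
  subst h
  simp [degreePart]

theorem degreePart_coeff_of_ne {c : ℝ} {m : ℤ} (h : (m : ℝ) ≠ c) (f : k⸨X⸩) :
    (degreePart c f).coeff m = 0 := by
  rw [degreePart]
  split_ifs with h'
  · exact HahnSeries.coeff_single_of_ne (by rintro rfl; exact h h')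
  · rfl

theorem euler_single (m : ℤ) :
    euler (HahnSeries.single m (1 : k)) = (m : k⸨X⸩) * HahnSeries.single m (1 : k) := by
  ext n
  have hC : ((m : ℤ) : k⸨X⸩) = HahnSeries.C (m : k) := (map_intCast HahnSeries.C m).symm
  rw [euler_coeff, hC, HahnSeries.C_mul_eq_smul, HahnSeries.coeff_smul, smul_eq_mul]
  rcases eq_or_ne n m with rfl | h
  · rfl
  · rw [HahnSeries.coeff_single_of_ne h, mul_zero, mul_zero]

end Laurent

/-! ### Filtrations in adapted bases -/

section Points

variable {k : Type u} [Field k]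
variable {U : Type v} [AddCommGroup U] [Module k⸨X⸩ U] [Module k⟦X⟧ U]
  [IsScalarTower k⟦X⟧ k⸨X⸩ U] [Module k U] [IsScalarTower k k⸨X⸩ U]

namespace BuildingPoint

/-- The point `x` lies in the apartment of `b`, with coordinates `a`. -/
def IsAdapted (x : BuildingPoint k U) (b : Module.Basis (Fin (Module.finrank k⸨X⸩ U)) k⸨X⸩ U) (a : Fin (Module.finrank k⸨X⸩ U) → ℝ) : Prop :=
  ∀ (r : ℝ) (u : U), u ∈ x.filt r ↔ ∀ i, VanishBelow (b.repr u i) (r - a i)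

theorem exists_isAdapted (x : BuildingPoint k U) : ∃ b a, x.IsAdapted b a := by
  obtain ⟨b, a, h⟩ := x.exists_apartment
  refine ⟨b, a, fun r u => (h r u).trans (forall_congr' fun i => forall_congr' fun m => ?_)⟩
  rw [lt_sub_iff_add_lt']

/-- The point with coordinates `a` in the apartment of `b`. -/
def ofBasis (b : Module.Basis (Fin (Module.finrank k⸨X⸩ U)) k⸨X⸩ U) (a : Fin (Module.finrank k⸨X⸩ U) → ℝ) : BuildingPoint k U where
  filt r :=
    { carrier := {u | ∀ i, VanishBelow (b.repr u i) (r - a i)}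
      add_mem' := fun hu hw i => by
        rw [map_add, Finsupp.add_apply]
        exact (hu i).add (hw i)
      zero_mem' := fun i => by
        rw [map_zero, Finsupp.zero_apply]
        exact VanishBelow.zero _
      smul_mem' := fun f u hu i => by
        rw [← algebraMap_smul k⸨X⸩ f u, map_smul, Finsupp.smul_apply, smul_eq_mul]
        exact ((VanishBelow.ofPowerSeries f).mul (hu i)).mono (by rw [zero_add]) }
  exists_apartment := ⟨b, a, fun r u => forall_congr' fun i => forall_congr' fun m => by
    rw [lt_sub_iff_add_lt']⟩

theorem ofBasis_isAdapted (b : Module.Basis (Fin (Module.finrank k⸨X⸩ U)) k⸨X⸩ U) (a : Fin (Module.finrank k⸨X⸩ U) → ℝ) :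
    (ofBasis b a).IsAdapted b a := fun _ _ => Iff.rfl

theorem smul_mem_filt_add (x : BuildingPoint k U) {f : k⸨X⸩} {c t : ℝ} {u : U}
    (hf : VanishBelow f c) (hu : u ∈ x.filt t) : f • u ∈ x.filt (t + c) := by
  obtain ⟨b, a, h⟩ := x.exists_isAdapted
  rw [h] at hu ⊢
  intro i
  rw [map_smul, Finsupp.smul_apply, smul_eq_mul]
  exact (hf.mul (hu i)).mono (by linarith)

theorem single_smul_mem_filt (x : BuildingPoint k U) (m : ℤ) {t : ℝ} {u : U} :
    (HahnSeries.single m (1 : k) : k⸨X⸩) • u ∈ x.filt (t + m) ↔ u ∈ x.filt t := by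
  refine ⟨fun h => ?_, x.smul_mem_filt_add (VanishBelow.single m 1)⟩
  have := x.smul_mem_filt_add (VanishBelow.single (-m) (1 : k)) h
  rw [smul_smul, HahnSeries.single_mul_single, neg_add_cancel, mul_one, HahnSeries.single_zero_one,
    one_smul] at this
  convert this using 2
  push_cast
  ring

theorem exists_mem_filt (x : BuildingPoint k U) (u : U) : ∃ t, u ∈ x.filt t := by
  obtain ⟨b, a, h⟩ := x.exists_isAdapted
  choose c hc using fun i => VanishBelow.exists_of (b.repr u i)
  obtain ⟨t, ht⟩ := Finite.exists_ge fun i => c i + a i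
  exact ⟨t, (h t u).2 fun i => (hc i).mono (by linarith [ht i])⟩

theorem exists_forall_mem_filt {ι : Type*} [Finite ι] (x : BuildingPoint k U) (e : ι → U) :
    ∃ t, ∀ i, e i ∈ x.filt t := by
  choose c hc using fun i => x.exists_mem_filt (e i)
  obtain ⟨t, ht⟩ := Finite.exists_ge c
  exact ⟨t, fun i => x.filt_antitone (ht i) (hc i)⟩

/-- The filtrations of two points differ by a bounded shift. -/
theorem exists_filt_le (x y : BuildingPoint k U) :
    ∃ c : ℝ, ∀ t, ∀ u ∈ x.filt t, u ∈ y.filt (t - c) := by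
  obtain ⟨b, a, h⟩ := x.exists_isAdapted
  obtain ⟨T, hT⟩ := y.exists_forall_mem_filt b
  obtain ⟨c, hc⟩ := Finite.exists_le fun i => a i - T
  refine ⟨c, fun t u hu => ?_⟩
  rw [← b.sum_repr u]
  exact sum_mem fun i _ => y.filt_antitone (by linarith [hc i])
    (y.smul_mem_filt_add ((h t u).1 hu i) (hT i))

namespace IsAdapted

variable {x : BuildingPoint k U} {b : Module.Basis (Fin (Module.finrank k⸨X⸩ U)) k⸨X⸩ U} {a : Fin (Module.finrank k⸨X⸩ U) → ℝ} (h : x.IsAdapted b a)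

include h

theorem basis_mem (i : Fin (Module.finrank k⸨X⸩ U)) : b i ∈ x.filt (a i) := by
  rw [h]
  intro j m hm
  rw [b.repr_self]
  rcases eq_or_ne i j with rfl | hij
  · rw [Finsupp.single_eq_same, HahnSeries.coeff_one, if_neg]
    rintro rfl
    simp at hm
  · rw [Finsupp.single_eq_of_ne (Ne.symm hij), HahnSeries.coeff_zero]

theorem mem_gl_iff {d : ℝ} {T : Module.End k⸨X⸩ U} :
    T ∈ x.gl d ↔ ∀ j, T (b j) ∈ x.filt (a j + d) := by
  refine ⟨fun hT j => hT _ _ (h.basis_mem j), fun hT s u hu => ?_⟩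
  rw [← b.sum_repr u, map_sum]
  refine sum_mem fun i _ => ?_
  rw [map_smul]
  exact x.filt_antitone (by linarith) (x.smul_mem_filt_add ((h s u).1 hu i) (hT i))

/-- The filtration has no jumps in a right neighbourhood of a given real number. -/
theorem mem_filtPlus_iff {t : ℝ} {u : U} :
    u ∈ x.filtPlus t ↔ ∀ i (m : ℤ), a i + m ≤ t → (b.repr u i).coeff m = 0 := by
  constructor
  · rintro ⟨s, hs, hu⟩ i m hm
    exact (h s u).1 hu i m (by linarith)
  · intro hu
    obtain ⟨ε, hε, hs⟩ := exists_pos_forall_le (g := fun i => a i + (⌊t - a i⌋ + 1 : ℤ) - t)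
      fun i => by
        have := Int.lt_floor_add_one (t - a i)
        push_cast
        linarith
    refine ⟨t + ε, by linarith, (h _ u).2 fun i m hm => hu i m ?_⟩
    have h1 : (m : ℝ) < (⌊t - a i⌋ + 1 : ℤ) := by linarith [hs i]
    have h2 : m ≤ ⌊t - a i⌋ := Int.lt_add_one_iff.1 (by exact_mod_cast h1)
    linarith [Int.le_floor.1 h2]

theorem mem_glPlus_iff {d : ℝ} {T : Module.End k⸨X⸩ U} :
    T ∈ x.glPlus d ↔ ∀ j, T (b j) ∈ x.filtPlus (a j + d) := by
  constructor
  · rintro ⟨s, hs, hT⟩ j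
    exact ⟨a j + s, by linarith, h.mem_gl_iff.1 hT j⟩
  · intro hT
    choose s hs hT using hT
    obtain ⟨ε, hε, hle⟩ := exists_pos_forall_le (g := fun j => s j - (a j + d))
      fun j => sub_pos.2 (hs j)
    exact ⟨d + ε, by linarith, h.mem_gl_iff.2 fun j =>
      x.filt_antitone (by linarith [hle j]) (hT j)⟩

end IsAdapted

end BuildingPoint

end Points

/-! ### Homogeneous endomorphisms -/

section Homogeneous

variable {k : Type u} [Field k]
variable {U : Type v} [AddCommGroup U] [Module k⸨X⸩ U] [Module k⟦X⟧ U]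
  [IsScalarTower k⟦X⟧ k⸨X⸩ U] [Module k U] [IsScalarTower k k⸨X⸩ U]

/-- The matrix entries of `T` in the basis `b` are homogeneous: `T` has degree `d` for the grading
in which `z^m b_i` has degree `a_i + m`. -/
def IsHomogeneousEnd (b : Module.Basis (Fin (Module.finrank k⸨X⸩ U)) k⸨X⸩ U)
    (a : Fin (Module.finrank k⸨X⸩ U) → ℝ) (d : ℝ) (T : Module.End k⸨X⸩ U) : Prop :=
  ∀ j i (m : ℤ), (b.repr (T (b j)) i).coeff m ≠ 0 → a i + m = a j + d

namespace IsHomogeneousEnd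

variable {b : Module.Basis (Fin (Module.finrank k⸨X⸩ U)) k⸨X⸩ U}
  {a : Fin (Module.finrank k⸨X⸩ U) → ℝ}

theorem repr_apply_apply (T : Module.End k⸨X⸩ U) (u : U) (i : Fin (Module.finrank k⸨X⸩ U)) :
    b.repr (T u) i = ∑ l, b.repr u l * b.repr (T (b l)) i := by
  have hu : T u = ∑ l, b.repr u l • T (b l) := by
    conv_lhs => rw [← b.sum_repr u, map_sum]
    simp_rw [map_smul]
  rw [hu, map_sum, Finsupp.finsetSum_apply]
  simp_rw [map_smul, Finsupp.smul_apply, smul_eq_mul]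

theorem mul {d d' : ℝ} {T S : Module.End k⸨X⸩ U} (hT : IsHomogeneousEnd b a d T)
    (hS : IsHomogeneousEnd b a d' S) : IsHomogeneousEnd b a (d + d') (T * S) := by
  intro j i m hm
  rw [Module.End.mul_apply, repr_apply_apply, HahnSeries.coeff_sum] at hm
  obtain ⟨l, -, hl⟩ := Finset.exists_ne_zero_of_sum_ne_zero hm
  rw [HahnSeries.coeff_mul] at hl
  obtain ⟨p, hp, hpm⟩ := Finset.exists_ne_zero_of_sum_ne_zero hl
  have hp' : p.1 + p.2 = m := (Finset.mem_antidiagonal.1 hp).2.2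
  have hp'' : (p.1 : ℝ) + p.2 = m := by exact_mod_cast hp'
  have h1 := hS j l p.1 (left_ne_zero_of_mul hpm)
  have h2 := hT l i p.2 (right_ne_zero_of_mul hpm)
  linarith

theorem one : IsHomogeneousEnd b a 0 1 := by
  intro j i m hm
  rw [Module.End.one_apply, b.repr_self] at hm
  rcases eq_or_ne i j with rfl | hij
  · rw [Finsupp.single_eq_same, HahnSeries.coeff_one] at hm
    obtain rfl : m = 0 := by
      by_contra hm0
      exact hm (if_neg hm0)
    simp
  · rw [Finsupp.single_eq_of_ne hij] at hm
    exact absurd rfl hm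

theorem pow {d : ℝ} {T : Module.End k⸨X⸩ U} (hT : IsHomogeneousEnd b a d T) (N : ℕ) :
    IsHomogeneousEnd b a (N * d) (T ^ N) := by
  induction N with
  | zero => simpa using one
  | succ N ih =>
    rw [pow_succ]
    convert ih.mul hT using 1
    push_cast
    ring

/-- An operator of pure degree d that raises every degree by more than d has nowhere to send a basis
vector. This turns filtration estimates into exact vanishing, hence into nilpotency. -/
theorem eq_zero {d : ℝ} {T : Module.End k⸨X⸩ U} (hT : IsHomogeneousEnd b a d T)
    {x : BuildingPoint k U} (h : x.IsAdapted b a) (hx : T ∈ x.glPlus d) : T = 0 := by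
  refine b.ext fun j => b.ext_elem fun i => ?_
  ext m
  rw [LinearMap.zero_apply, map_zero, Finsupp.zero_apply, HahnSeries.coeff_zero]
  by_contra hm
  exact hm (h.mem_filtPlus_iff.1 (h.mem_glPlus_iff.1 hx j) i m (hT j i m hm).le)

theorem mem_gl {d : ℝ} {T : Module.End k⸨X⸩ U} (hT : IsHomogeneousEnd b a d T)
    {x : BuildingPoint k U} (h : x.IsAdapted b a) : T ∈ x.gl d := by
  refine h.mem_gl_iff.2 fun j => (h _ _).2 fun i m hm => ?_
  by_contra hm'
  have := hT j i m hm'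
  linarith

end IsHomogeneousEnd

theorem BuildingPoint.mul_mem_gl (x : BuildingPoint k U) {d d' : ℝ} {T S : Module.End k⸨X⸩ U}
    (hT : T ∈ x.gl d) (hS : S ∈ x.gl d') : T * S ∈ x.gl (d + d') := fun s u hu =>
  x.filt_antitone (by linarith) (hT _ _ (hS s u hu))

theorem BuildingPoint.pow_mem_gl (x : BuildingPoint k U) {d : ℝ} {T : Module.End k⸨X⸩ U}
    (hT : T ∈ x.gl d) (N : ℕ) : T ^ N ∈ x.gl (N * d) := by
  induction N with
  | zero => exact fun s u hu => by simpa using hu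
  | succ N ih =>
    rw [pow_succ, Nat.cast_succ, add_one_mul]
    exact x.mul_mem_gl ih hT

/-- If `T` and `S` agree to leading order `d`, then so do their powers. -/
theorem BuildingPoint.pow_sub_pow_mem_gl (x : BuildingPoint k U) {d ε : ℝ}
    {T S : Module.End k⸨X⸩ U} (hT : T ∈ x.gl d) (hS : S ∈ x.gl d) (h : T - S ∈ x.gl (d + ε))
    (N : ℕ) : T ^ N - S ^ N ∈ x.gl (N * d + ε) := by
  induction N with
  | zero => simp
  | succ N ih =>
    have : T ^ (N + 1) - S ^ (N + 1) = T ^ N * (T - S) + (T ^ N - S ^ N) * S := by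
      rw [pow_succ, pow_succ, mul_sub, sub_mul]
      abel
    rw [this]
    exact add_mem (x.gl_antitone (by push_cast; linarith) (x.mul_mem_gl (x.pow_mem_gl hT N) h))
      (x.gl_antitone (by push_cast; linarith) (x.mul_mem_gl ih hS))

end Homogeneous

/-! ### Growth of the iterates of the connection -/

namespace Connection

section Growth

variable {k : Type u} [Field k]
variable {U : Type v} [AddCommGroup U] [Module k⸨X⸩ U] [Module k⟦X⟧ U]
  [IsScalarTower k⟦X⟧ k⸨X⸩ U] [Module k U] [IsScalarTower k k⸨X⸩ U]

variable (D : Connection k U)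

/-- `∇_τ` lowers the degree of the filtration of `x` by at most `r`. -/
def LowersBy (x : BuildingPoint k U) (r : ℝ) : Prop :=
  ∀ t, ∀ u ∈ x.filt t, D.op u ∈ x.filt (t - r)

/-- It suffices to test on the basis: the extra term τ(f_j) b_j stays in degree t, which is why the
gain d cannot be positive. -/
theorem op_sub_mem_filt {x : BuildingPoint k U}
    {b : Module.Basis (Fin (Module.finrank k⸨X⸩ U)) k⸨X⸩ U}
    {a : Fin (Module.finrank k⸨X⸩ U) → ℝ} (h : x.IsAdapted b a) {T : Module.End k⸨X⸩ U} {d : ℝ}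
    (hd : d ≤ 0) (hT : ∀ j, D.op (b j) - T (b j) ∈ x.filt (a j + d)) {t : ℝ} {u : U}
    (hu : u ∈ x.filt t) : D.op u - T u ∈ x.filt (t + d) := by
  have hu' : D.op u - T u =
      ∑ j, (euler (b.repr u j) • b j + b.repr u j • (D.op (b j) - T (b j))) := by
    conv_lhs => rw [← b.sum_repr u]
    rw [map_sum, map_sum, ← Finset.sum_sub_distrib]
    refine Finset.sum_congr rfl fun j _ => ?_
    rw [D.leibniz, map_smul, smul_sub, add_sub_assoc]
  rw [hu']
  refine sum_mem fun j _ => add_mem ?_ ?_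
  · exact x.filt_antitone (by linarith)
      (x.smul_mem_filt_add ((h _ _).1 hu j).euler (h.basis_mem j))
  · exact x.filt_antitone (by linarith) (x.smul_mem_filt_add ((h _ _).1 hu j) (hT j))

theorem lowersBy_of_basis {x : BuildingPoint k U}
    {b : Module.Basis (Fin (Module.finrank k⸨X⸩ U)) k⸨X⸩ U}
    {a : Fin (Module.finrank k⸨X⸩ U) → ℝ} (h : x.IsAdapted b a) {r : ℝ} (hr : 0 ≤ r)
    (hb : ∀ j, D.op (b j) ∈ x.filt (a j - r)) : D.LowersBy x r := fun t u hu => by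
  have := D.op_sub_mem_filt h (T := 0) (neg_nonpos.2 hr) (by simpa [← sub_eq_add_neg] using hb) hu
  simpa [← sub_eq_add_neg] using this

/-- The homogeneous part of degree `-r` of the matrix of `∇_τ` in the basis `b`. -/
def leadingPart (b : Module.Basis (Fin (Module.finrank k⸨X⸩ U)) k⸨X⸩ U)
    (a : Fin (Module.finrank k⸨X⸩ U) → ℝ) (r : ℝ) : Module.End k⸨X⸩ U :=
  b.constr k⸨X⸩ fun j => ∑ i, degreePart (a j - r - a i) (b.repr (D.op (b j)) i) • b i

variable {D}

theorem repr_leadingPart (b : Module.Basis (Fin (Module.finrank k⸨X⸩ U)) k⸨X⸩ U)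
    (a : Fin (Module.finrank k⸨X⸩ U) → ℝ) (r : ℝ) (j i : Fin (Module.finrank k⸨X⸩ U)) :
    b.repr (D.leadingPart b a r (b j)) i =
      degreePart (a j - r - a i) (b.repr (D.op (b j)) i) := by
  rw [leadingPart, b.constr_basis, b.repr_sum_self]

theorem leadingPart_isHomogeneous (b : Module.Basis (Fin (Module.finrank k⸨X⸩ U)) k⸨X⸩ U)
    (a : Fin (Module.finrank k⸨X⸩ U) → ℝ) (r : ℝ) :
    IsHomogeneousEnd b a (-r) (D.leadingPart b a r) := by
  intro j i m hm
  rw [repr_leadingPart] at hm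
  by_contra h
  exact hm (degreePart_coeff_of_ne (fun h' => h (by rw [h']; ring)) _)

/-- Finitely many basis vectors give a uniform gain ε. It is capped at r since the Leibniz terms
only stay in degree t; positivity of the gain therefore needs r > 0. -/
theorem exists_op_sub_leadingPart_mem {x : BuildingPoint k U}
    {b : Module.Basis (Fin (Module.finrank k⸨X⸩ U)) k⸨X⸩ U}
    {a : Fin (Module.finrank k⸨X⸩ U) → ℝ} (h : x.IsAdapted b a) {r : ℝ} (hr : 0 < r)
    (hD : D.LowersBy x r) : ∃ ε : ℝ, 0 < ε ∧ ∀ t, ∀ u ∈ x.filt t,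
      D.op u - D.leadingPart b a r u ∈ x.filt (t - r + ε) := by
  have hj : ∀ j, D.op (b j) - D.leadingPart b a r (b j) ∈ x.filtPlus (a j - r) := by
    refine fun j => h.mem_filtPlus_iff.2 fun i m hm => ?_
    rw [map_sub, Finsupp.sub_apply, HahnSeries.coeff_sub, repr_leadingPart]
    rcases hm.eq_or_lt with hm | hm
    · rw [degreePart_coeff_of_eq (by linarith), sub_self]
    · rw [degreePart_coeff_of_ne (by intro h'; linarith), sub_zero]
      exact (h _ _).1 (hD _ _ (h.basis_mem j)) i m (by linarith)
  choose s hs hj using hj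
  obtain ⟨ε, hε, hle⟩ := exists_pos_forall_le (g := fun j => s j - (a j - r))
    fun j => sub_pos.2 (hs j)
  refine ⟨min ε r, lt_min hε hr, fun t u hu => ?_⟩
  have := D.op_sub_mem_filt h (d := -r + min ε r) (by linarith [min_le_right ε r])
    (fun j => x.filt_antitone (by linarith [min_le_left ε r, hle j]) (hj j)) hu
  rwa [← add_assoc, ← sub_eq_add_neg] at this

namespace LowersBy

variable {x : BuildingPoint k U} {r : ℝ} (hD : D.LowersBy x r)
include hD

theorem pow_mem (i : ℕ) {t : ℝ} {u : U} (hu : u ∈ x.filt t) :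
    (D.op ^ i) u ∈ x.filt (t - i * r) := by
  induction i with
  | zero => simpa using hu
  | succ i ih =>
    rw [pow_succ', Module.End.mul_apply]
    exact x.filt_antitone (by push_cast; linarith) (hD _ _ ih)

theorem pow_sub_pow_mem {T : Module.End k⸨X⸩ U} {ε : ℝ} (hT : T ∈ x.gl (-r))
    (hDT : ∀ t, ∀ u ∈ x.filt t, D.op u - T u ∈ x.filt (t - r + ε)) (N : ℕ) {t : ℝ} {u : U}
    (hu : u ∈ x.filt t) : (D.op ^ N) u - (T ^ N) u ∈ x.filt (t - N * r + ε) := by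
  induction N with
  | zero => simp
  | succ N ih =>
    have : (D.op ^ (N + 1)) u - (T ^ (N + 1)) u = D.op ((D.op ^ N) u - (T ^ N) u) +
        (D.op ((T ^ N) u) - T ((T ^ N) u)) := by
      rw [pow_succ', pow_succ', Module.End.mul_apply, Module.End.mul_apply, map_sub]
      abel
    rw [this]
    exact add_mem (x.filt_antitone (by push_cast; linarith) (hD _ _ ih))
      (x.filt_antitone (by push_cast; linarith) (hDT _ _ (x.pow_mem_gl hT N _ _ hu)))

/-- Lower bound for the growth of the iterates of `∇_τ`. -/
theorem exists_forall_pow_mem {ι : Type*} [Finite ι] (y : BuildingPoint k U) (e : ι → U) :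
    ∃ C : ℝ, ∀ (i : ℕ) (j : ι), (D.op ^ i) (e j) ∈ y.filt (-(r * i) - C) := by
  obtain ⟨c, hc⟩ := x.exists_filt_le y
  obtain ⟨t, ht⟩ := x.exists_forall_mem_filt e
  exact ⟨c - t, fun i j => y.filt_antitone (by linarith) (hc _ _ (hD.pow_mem i (ht j)))⟩

variable {b : Module.Basis (Fin (Module.finrank k⸨X⸩ U)) k⸨X⸩ U}
  {a : Fin (Module.finrank k⸨X⸩ U) → ℝ} (h : x.IsAdapted b a) (hr : 0 < r)
include h hr

/-- The growth is strictly slower if the leading part is nilpotent. -/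
theorem exists_lt_forall_pow_mem (hnil : IsNilpotent (D.leadingPart b a r)) {ι : Type*} [Finite ι]
    (y : BuildingPoint k U) (e : ι → U) :
    ∃ r' < r, ∃ C : ℝ, ∀ (i : ℕ) (j : ι), (D.op ^ i) (e j) ∈ y.filt (-(r' * i) - C) := by
  obtain ⟨ε, hε, hDε⟩ := exists_op_sub_leadingPart_mem h hr hD
  obtain ⟨N, hN⟩ := hnil
  obtain ⟨c, hc⟩ := x.exists_filt_le y
  obtain ⟨t, ht⟩ := x.exists_forall_mem_filt e
  -- A block of N + 1 iterations kills the leading part and gains ε. The exponent N + 1, unlike N,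
  -- is never zero, so the gain can be averaged over the block.
  have hstep : ∀ (t : ℝ) (u : U), u ∈ x.filt t →
      (D.op ^ (N + 1)) u ∈ x.filt (t - (N + 1 : ℕ) * r + ε) := fun t u hu => by
    have := hD.pow_sub_pow_mem ((leadingPart_isHomogeneous b a r).mem_gl h) hDε (N + 1) hu
    rwa [pow_succ (D.leadingPart b a r), hN, zero_mul, LinearMap.zero_apply, sub_zero] at this
  have hstep' : ∀ (q : ℕ) (t : ℝ) (u : U), u ∈ x.filt t →
      ((D.op ^ (N + 1)) ^ q) u ∈ x.filt (t - q * ((N + 1 : ℕ) * r - ε)) := fun q => by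
    induction q with
    | zero => simp
    | succ q ih =>
      intro t u hu
      rw [pow_succ', Module.End.mul_apply]
      exact x.filt_antitone (by push_cast; linarith) (hstep _ _ (ih t u hu))
  have hN0 : (0 : ℝ) < (N + 1 : ℕ) := by positivity
  -- The rate improves by the average gain; the extra ε in the constant pays for the incomplete last
  -- block.
  refine ⟨r - ε / (N + 1 : ℕ), by linarith [div_pos hε hN0], c - t + ε, fun i j => ?_⟩
  have hi := Nat.div_add_mod i (N + 1)
  set q := i / (N + 1)
  set p := i % (N + 1)
  have hp : p < N + 1 := Nat.mod_lt _ (Nat.succ_pos N)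
  have hi' : (i : ℝ) = (N + 1 : ℕ) * q + p := by exact_mod_cast hi.symm
  rw [← hi, pow_add, Module.End.mul_apply, pow_mul]
  refine y.filt_antitone ?_ (hc _ _ (hstep' q _ _ (hD.pow_mem p (ht j))))
  have h1 : ε / (N + 1 : ℕ) * ((N + 1 : ℕ) * q + p) = ε * q + ε * (p / (N + 1 : ℕ)) := by
    field_simp
  have h2 : (p : ℝ) / (N + 1 : ℕ) ≤ 1 := (div_le_one hN0).2 (by exact_mod_cast hp.le)
  have h3 := mul_le_mul_of_nonneg_left h2 hε.le
  rw [hi, hi', sub_mul, h1]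
  linarith

/-- If the leading part is not nilpotent, every iterate of `∇_τ` lowers some degree by the maximal
amount. -/
theorem exists_pow_notMem (hnil : ¬ IsNilpotent (D.leadingPart b a r)) (i : ℕ) :
    ∃ t, ∃ u ∈ x.filt t, (D.op ^ i) u ∉ x.filt (t - i * r + 1) := by
  obtain ⟨ε, hε, hDε⟩ := exists_op_sub_leadingPart_mem h hr hD
  by_contra! hcon
  have hom := leadingPart_isHomogeneous (D := D) b a r
  -- If the i-th iterate always gained 1, the i-th power of the leading part, equal to it up to a
  -- gain of ε, would gain min ε 1 over its own degree and so vanish.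
  refine hnil ⟨i, (hom.pow i).eq_zero h ⟨-(i * r) + min ε 1, ?_, fun t u hu => ?_⟩⟩
  · linarith [lt_min hε one_pos]
  · have h1 := hD.pow_sub_pow_mem (hom.mem_gl h) hDε i hu
    have h2 := hcon t u hu
    have h3 : _ ∈ x.filt (t + (-(i * r) + min ε 1)) :=
      sub_mem (x.filt_antitone (by linarith [min_le_right ε 1]) h2)
        (x.filt_antitone (by linarith [min_le_left ε 1]) h1)
    rwa [sub_sub_cancel] at h3

end LowersBy

theorem pow_smul_mem (x : BuildingPoint k U) (i : ℕ) : ∀ {u : U} {f : k⸨X⸩} {c T : ℝ},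
    VanishBelow f c → (∀ l ≤ i, (D.op ^ l) u ∈ x.filt T) → (D.op ^ i) (f • u) ∈ x.filt (T + c) := by
  induction i with
  | zero => exact fun hf hu => x.smul_mem_filt_add hf (hu 0 le_rfl)
  | succ i ih =>
    intro u f c T hf hu
    rw [pow_succ, Module.End.mul_apply, D.leibniz, map_add]
    refine add_mem (ih hf.euler fun l hl => hu l (by omega)) (ih hf fun l hl => ?_)
    have := hu (l + 1) (by omega)
    rwa [pow_succ, Module.End.mul_apply] at this

/-- Upper bound for the growth of the iterates of `∇_τ`. -/
theorem LowersBy.exists_forall_pow_notMem {x : BuildingPoint k U} {r : ℝ} (hD : D.LowersBy x r)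
    {b : Module.Basis (Fin (Module.finrank k⸨X⸩ U)) k⸨X⸩ U}
    {a : Fin (Module.finrank k⸨X⸩ U) → ℝ} (h : x.IsAdapted b a) (hr : 0 < r)
    (hnil : ¬ IsNilpotent (D.leadingPart b a r)) (y : BuildingPoint k U)
    (e : Module.Basis (Fin (Module.finrank k⸨X⸩ U)) k⸨X⸩ U) :
    ∃ C : ℝ, ∀ i : ℕ, ∃ j, (D.op ^ i) (e j) ∉ y.filt (-(r * i) + C) := by
  obtain ⟨c, hc⟩ := y.exists_filt_le x
  suffices H : ∃ C : ℝ, ∀ i : ℕ, ∃ j, (D.op ^ i) (e j) ∉ x.filt (-(r * i) + C) by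
    obtain ⟨C, hC⟩ := H
    refine ⟨C + c, fun i => ?_⟩
    obtain ⟨j, hj⟩ := hC i
    exact ⟨j, fun h' => hj (x.filt_antitone (by linarith) (hc _ _ h'))⟩
  obtain ⟨c₂, hc₂⟩ := x.exists_filt_le (BuildingPoint.ofBasis e 0)
  obtain ⟨c₁, hc₁⟩ := x.exists_forall_mem_filt e
  -- A vector on which `∇_τ^i` loses the full amount is expanded in e. By Leibniz, some iterate of
  -- order l ≤ i must already lose almost as much on some e_j.
  have key : ∀ i : ℕ, ∃ l ≤ i, ∃ j, (D.op ^ l) (e j) ∉ x.filt (-(r * i) + (1 + c₂)) := by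
    intro i
    by_contra! hcon
    obtain ⟨t, u, hu, hui⟩ := hD.exists_pow_notMem h hr hnil i
    refine hui ?_
    rw [← e.sum_repr u, map_sum]
    refine sum_mem fun j _ => ?_
    have hj := (BuildingPoint.ofBasis_isAdapted e 0 _ _).1 (hc₂ _ _ hu) j
    exact x.filt_antitone (by simp; linarith) (pow_smul_mem x i hj fun l hl => hcon l hl j)
  -- K makes `key` at i + K incompatible with l ≤ i. Thus i < l ≤ i + K, and since the last l - i
  -- steps lose at most Kr, the loss is already present at step i.
  obtain ⟨K, hK⟩ := exists_nat_gt ((1 + c₂ - c₁) / r)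
  rw [div_lt_iff₀ hr] at hK
  refine ⟨1 + c₂, fun i => ?_⟩
  obtain ⟨l, hl, j, hj⟩ := key (i + K)
  have hil : i < l := by
    by_contra! hli
    refine hj (x.filt_antitone ?_ (hD.pow_mem l (hc₁ j)))
    have : (l : ℝ) * r ≤ i * r := mul_le_mul_of_nonneg_right (by exact_mod_cast hli) hr.le
    push_cast
    linarith
  refine ⟨j, fun hij => hj ?_⟩
  obtain ⟨p, rfl⟩ := Nat.exists_eq_add_of_lt hil
  rw [show i + p + 1 = (p + 1) + i by ring, pow_add, Module.End.mul_apply]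
  refine x.filt_antitone ?_ (hD.pow_mem (p + 1) hij)
  have hp : ((p + 1 : ℕ) : ℝ) * r ≤ K * r :=
    mul_le_mul_of_nonneg_right (by exact_mod_cast (by omega : p + 1 ≤ K)) hr.le
  push_cast at hp ⊢
  linarith

end Growth

end Connection

/-! ### Residue pairing, representatives and contained strata -/

section Strata

variable {k : Type u} [Field k]
variable {U : Type v} [AddCommGroup U] [Module k⸨X⸩ U] [Module k⟦X⟧ U]
  [IsScalarTower k⟦X⟧ k⸨X⸩ U] [Module k U] [IsScalarTower k k⸨X⸩ U]

theorem trace_eq_sum_repr {ι : Type*} [Fintype ι] (b : Module.Basis ι k⸨X⸩ U)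
    (T : Module.End k⸨X⸩ U) :
    LinearMap.trace k⸨X⸩ U T = ∑ i, b.repr (T (b i)) i := by
  classical
  rw [LinearMap.trace_eq_matrix_trace k⸨X⸩ b, Matrix.trace]
  simp [LinearMap.toMatrix_apply]

namespace BuildingPoint

variable (x : BuildingPoint k U)

theorem trace_coeff_zero {T : Module.End k⸨X⸩ U} (hT : T ∈ x.glPlus 0) :
    (LinearMap.trace k⸨X⸩ U T).coeff 0 = 0 := by
  obtain ⟨b, a, h⟩ := x.exists_isAdapted
  rw [trace_eq_sum_repr b, HahnSeries.coeff_sum]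
  refine Finset.sum_eq_zero fun i _ => ?_
  exact h.mem_filtPlus_iff.1 (h.mem_glPlus_iff.1 hT i) i 0 (by simp)

theorem mul_mem_glPlus_left {d d' : ℝ} {T S : Module.End k⸨X⸩ U}
    (hT : T ∈ x.glPlus d) (hS : S ∈ x.gl d') : T * S ∈ x.glPlus (d + d') := by
  obtain ⟨s, hs, hT⟩ := hT
  exact ⟨s + d', by linarith, x.mul_mem_gl hT hS⟩

theorem mul_mem_glPlus_right {d d' : ℝ} {T S : Module.End k⸨X⸩ U}
    (hT : T ∈ x.gl d) (hS : S ∈ x.glPlus d') : T * S ∈ x.glPlus (d + d') := by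
  obtain ⟨s, hs, hS⟩ := hS
  exact ⟨d + s, by linarith, x.mul_mem_gl hT hS⟩

/-- The residue pairing between `𝔤𝔩(U)_{x,-r}` and `𝔤𝔩(U)_{x,r}` has left kernel
`𝔤𝔩(U)_{x,-r+}`. -/
theorem mem_glPlus_of_trace {r : ℝ} {T : Module.End k⸨X⸩ U} (hT : T ∈ x.gl (-r))
    (h0 : ∀ Z ∈ x.gl r, (LinearMap.trace k⸨X⸩ U (T * Z)).coeff 0 = 0) : T ∈ x.glPlus (-r) := by
  obtain ⟨b, a, h⟩ := x.exists_isAdapted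
  refine h.mem_glPlus_iff.2 fun j => h.mem_filtPlus_iff.2 fun i m hm => ?_
  rcases hm.lt_or_eq with hm | hm
  · exact (h _ _).1 (h.mem_gl_iff.1 hT j) i m (by linarith)
  -- The test operator is the elementary matrix sending b_i to z^{-m} b_j. As a_i + m = a_j - r, it
  -- has degree r, and its pairing with T is precisely the coefficient to be killed.
  set g : k⸨X⸩ := HahnSeries.single (-m) 1 with hg
  set Z : Module.End k⸨X⸩ U := (b.coord i).smulRight (g • b j)
  have hZ : ∀ l, Z (b l) = if l = i then g • b j else 0 := by
    intro l
    rw [LinearMap.smulRight_apply, b.coord_apply, b.repr_self, Finsupp.single_apply]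
    split_ifs <;> simp
  have hZr : Z ∈ x.gl r := by
    refine h.mem_gl_iff.2 fun l => ?_
    rw [hZ]
    split_ifs with hl
    · subst hl
      refine x.filt_antitone ?_ (x.smul_mem_filt_add (VanishBelow.single (-m) 1) (h.basis_mem j))
      push_cast
      linarith
    · exact zero_mem _
  have htr : LinearMap.trace k⸨X⸩ U (T * Z) = g * b.repr (T (b j)) i := by
    rw [trace_eq_sum_repr b, Finset.sum_eq_single i]
    · rw [Module.End.mul_apply, hZ, if_pos rfl, map_smul, map_smul, Finsupp.smul_apply, smul_eq_mul]
    · intro l _ hl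
      rw [Module.End.mul_apply, hZ, if_neg hl, map_zero, map_zero, Finsupp.zero_apply]
    · simp
  have := h0 Z hZr
  rw [htr, hg] at this
  have h' := HahnSeries.coeff_single_mul_add (r := (1 : k)) (x := b.repr (T (b j)) i) (a := m)
    (b := -m)
  rw [add_neg_cancel, this, one_mul] at h'
  exact h'.symm

/-- The functional on `𝔤𝔩(U)_{x,r}` induced by `Z ↦ Res Tr(Y Z) dz/z`. -/
def residuePairing (r : ℝ) (Y : Module.End k⸨X⸩ U) : Module.Dual k (x.gl r) where
  toFun Z := (LinearMap.trace k⸨X⸩ U (Y * (Z : Module.End k⸨X⸩ U))).coeff 0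
  map_add' Z W := by
    rw [Submodule.coe_add, mul_add, map_add, HahnSeries.coeff_add]
  map_smul' c Z := by
    have : Y * ((c • Z : x.gl r) : Module.End k⸨X⸩ U) =
        (HahnSeries.C c : k⸨X⸩) • (Y * (Z : Module.End k⸨X⸩ U)) := by
      ext u
      rw [Module.End.mul_apply, Submodule.coe_smul, LinearMap.smul_apply, ← C_smul, map_smul]
      rfl
    rw [this, map_smul, smul_eq_mul, HahnSeries.C_mul_eq_smul, HahnSeries.coeff_smul]
    rfl

/-- The stratum represented by `Y`. -/
def stratum {r : ℝ} (hr : 0 ≤ r) {Y : Module.End k⸨X⸩ U} (hY : Y ∈ x.gl (-r)) : Stratum k U where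
  point := x
  depth := r
  depth_nonneg := hr
  functional := Submodule.liftQ _ (x.residuePairing r Y) fun Z hZ =>
    x.trace_coeff_zero (by
      have := x.mul_mem_glPlus_right hY (Submodule.mem_comap.1 hZ)
      rwa [neg_add_cancel] at this)

theorem stratum_isRepresentative {r : ℝ} (hr : 0 ≤ r) {Y : Module.End k⸨X⸩ U}
    (hY : Y ∈ x.gl (-r)) : (x.stratum hr hY).IsRepresentative Y :=
  ⟨hY, fun _ => rfl⟩

end BuildingPoint

namespace Stratum

variable {S : Stratum k U} {Y Y' : Module.End k⸨X⸩ U}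

theorem IsRepresentative.sub_mem_glPlus (hY : S.IsRepresentative Y) (hY' : S.IsRepresentative Y') :
    Y - Y' ∈ S.point.glPlus (-S.depth) := by
  refine S.point.mem_glPlus_of_trace (sub_mem hY.1 hY'.1) fun Z hZ => ?_
  rw [sub_mul, map_sub, HahnSeries.coeff_sub, ← hY.2 ⟨Z, hZ⟩, ← hY'.2 ⟨Z, hZ⟩, sub_self]

theorem IsRepresentative.of_sub_mem (hY : S.IsRepresentative Y)
    (h : Y - Y' ∈ S.point.glPlus (-S.depth)) : S.IsRepresentative Y' := by
  have hle : S.point.glPlus (-S.depth) ≤ S.point.gl (-S.depth) := by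
    rintro T ⟨s, hs, hT⟩
    exact S.point.gl_antitone hs.le hT
  refine ⟨by simpa using sub_mem hY.1 (hle h), fun Z => ?_⟩
  have := S.point.trace_coeff_zero (by simpa using S.point.mul_mem_glPlus_left h Z.2)
  rw [hY.2, ← sub_eq_zero, ← HahnSeries.coeff_sub, ← map_sub, ← sub_mul, this]

end Stratum

namespace Connection

variable [Algebra ℝ k] {D : Connection k U} {S : Stratum k U}

theorem Contains.lowersBy (hS : D.Contains S) : D.LowersBy S.point S.depth := by
  obtain ⟨Y, hY, hD⟩ := hS
  intro t u hu
  obtain ⟨s, hs, hu'⟩ := hD t u hu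
  have h1 := S.point.filt_antitone hs.le hu'
  have h2 : algebraMap ℝ k t • u ∈ S.point.filt (t - S.depth) :=
    S.point.filt_antitone (by linarith [S.depth_nonneg]) (S.point.smul_mem_filt _ hu)
  have h3 := add_mem (add_mem h1 (hY.1 t u hu)) h2
  rwa [sub_add_cancel, sub_add_cancel] at h3

theorem LowersBy.exists_contains {x : BuildingPoint k U} {r : ℝ} (hD : D.LowersBy x r)
    (hr : 0 ≤ r) : ∃ S : Stratum k U, D.Contains S ∧ S.depth = r := by
  obtain ⟨b, a, h⟩ := x.exists_isAdapted
  -- On z^m b_j the operator `∇_τ` - Y acts as the scalar a_j + m, its degree. Subtracting t thus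
  -- kills the degree t component and leaves only higher degrees.
  set Y : Module.End k⸨X⸩ U :=
    b.constr k⸨X⸩ fun j => D.op (b j) - algebraMap ℝ k (a j) • b j with hYdef
  have hYb : ∀ j, Y (b j) = D.op (b j) - algebraMap ℝ k (a j) • b j := fun j => by
    rw [hYdef, b.constr_basis]
  have hY : Y ∈ x.gl (-r) := by
    refine h.mem_gl_iff.2 fun j => ?_
    rw [hYb]
    exact sub_mem (hD _ _ (h.basis_mem j))
      (x.filt_antitone (by linarith) (x.smul_mem_filt _ (h.basis_mem j)))
  refine ⟨x.stratum hr hY, ⟨Y, x.stratum_isRepresentative hr hY, fun t u hu => ?_⟩, rfl⟩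
  have hu' : D.op u - algebraMap ℝ k t • u - Y u = ∑ j, (euler (b.repr u j) +
      (HahnSeries.C (algebraMap ℝ k (a j - t)) : k⸨X⸩) * b.repr u j) • b j := by
    conv_lhs => rw [← b.sum_repr u]
    rw [map_sum, map_sum, Finset.smul_sum, ← Finset.sum_sub_distrib, ← Finset.sum_sub_distrib]
    refine Finset.sum_congr rfl fun j _ => ?_
    have hC : ((HahnSeries.C (algebraMap ℝ k (a j - t)) : k⸨X⸩) * b.repr u j) • b j =
        b.repr u j • algebraMap ℝ k (a j) • b j - algebraMap ℝ k t • b.repr u j • b j := by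
      rw [mul_smul, C_smul, map_sub, sub_smul, smul_comm (b.repr u j)]
    rw [D.leibniz, map_smul, hYb, add_smul, hC, smul_sub]
    abel
  change _ ∈ x.filtPlus (t - r)
  have hplus : D.op u - algebraMap ℝ k t • u - Y u ∈ x.filtPlus t := by
    refine h.mem_filtPlus_iff.2 fun i m hm => ?_
    rw [hu', b.repr_sum_self, HahnSeries.coeff_add, euler_coeff, HahnSeries.C_mul_eq_smul,
      HahnSeries.coeff_smul, smul_eq_mul, ← add_mul]
    rcases hm.lt_or_eq with hm | hm
    · rw [(h _ _).1 hu i m (by linarith), mul_zero]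
    · rw [show a i - t = -(m : ℝ) by linarith, map_neg, map_intCast, add_neg_cancel, zero_mul]
  obtain ⟨s, hs, hu''⟩ := hplus
  exact ⟨s, by linarith, hu''⟩

/-- For positive depth the scalar j in the containment condition has higher order, so the leading
part represents β. If another representative has zero N-th power, the N-th power of the leading part
lies in strictly higher degree than its own and vanishes by homogeneity. -/
theorem Contains.isFundamental_iff (hS : D.Contains S) (hr : 0 < S.depth)
    {b : Module.Basis (Fin (Module.finrank k⸨X⸩ U)) k⸨X⸩ U}
    {a : Fin (Module.finrank k⸨X⸩ U) → ℝ} (h : S.point.IsAdapted b a) :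
    S.IsFundamental ↔ ¬ IsNilpotent (D.leadingPart b a S.depth) := by
  have hom := leadingPart_isHomogeneous (D := D) b a S.depth
  have hlow := hS.lowersBy
  obtain ⟨Y, hY, hD⟩ := hS
  obtain ⟨ε, hε, hDε⟩ := exists_op_sub_leadingPart_mem h hr hlow
  have hsub : Y - D.leadingPart b a S.depth ∈ S.point.glPlus (-S.depth) := by
    refine h.mem_glPlus_iff.2 fun j => ?_
    rw [← sub_eq_add_neg]
    have h1 := hD _ _ (h.basis_mem j)
    have h2 : algebraMap ℝ k (a j) • b j ∈ S.point.filtPlus (a j - S.depth) :=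
      ⟨a j, by linarith, S.point.smul_mem_filt _ (h.basis_mem j)⟩
    have h3 : D.op (b j) - D.leadingPart b a S.depth (b j) ∈ S.point.filtPlus (a j - S.depth) :=
      ⟨_, by linarith, hDε _ _ (h.basis_mem j)⟩
    have h4 := sub_mem (sub_mem h3 h1) h2
    convert h4 using 1
    rw [LinearMap.sub_apply]
    abel
  have hrep := hY.of_sub_mem hsub
  refine ⟨fun hf => hf _ hrep, fun hnil Y' hY' ⟨N, hN⟩ => hnil ⟨N, ?_⟩⟩
  obtain ⟨s, hs, hmem⟩ := hrep.sub_mem_glPlus hY'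
  refine (hom.pow N).eq_zero h ⟨N * -S.depth + (s + S.depth), by linarith, ?_⟩
  have := S.point.pow_sub_pow_mem_gl hrep.1 hY'.1 (ε := s + S.depth) (by simpa using hmem) N
  rwa [hN, sub_zero] at this

end Connection

end Strata

/-! ### Generic perturbation of linearly dependent vectors -/

section Polynomials

theorem exists_eval_natCast_ne_zero {R : Type*} [CommRing R] [IsDomain R] [CharZero R]
    {p : Polynomial R} (hp : p ≠ 0) : ∃ n : ℕ, p.eval (n : R) ≠ 0 := by
  by_contra! h
  exact hp (p.eq_zero_of_infinite_isRoot
    (Set.infinite_of_injective_forall_mem (Nat.cast_injective (R := R)) h))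

/-- A family of vectors with vanishing last coordinates becomes independent after a generic
perturbation, as soon as it does so to first order. -/
theorem exists_natCast_linearIndependent {K : Type*} [Field K] [CharZero K] {m : ℕ}
    (A B : Matrix (Fin m ⊕ Fin 1) (Fin m ⊕ Fin 1) K)
    (hA : ∀ i, A (Sum.inl i) = Pi.single (Sum.inl i) 1) (hA0 : ∀ i, A i (Sum.inr 0) = 0)
    (hB : B (Sum.inr 0) (Sum.inr 0) -
      ∑ l, A (Sum.inr 0) (Sum.inl l) * B (Sum.inl l) (Sum.inr 0) ≠ 0) :
    ∃ c : ℕ, LinearIndependent K fun i => A i + (c : K) • B i := by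
  -- the matrix of the perturbed vectors, with its last column divided by the parameter
  let M : Matrix (Fin m ⊕ Fin 1) (Fin m ⊕ Fin 1) (Polynomial K) := fun i =>
    Sum.elim (fun l => Polynomial.C (A i (Sum.inl l)) +
      Polynomial.X * Polynomial.C (B i (Sum.inl l))) fun _ => Polynomial.C (B i (Sum.inr 0))
  have hMl : ∀ (c : K) i l, (M.map (Polynomial.evalRingHom c)) i (Sum.inl l) =
      A i (Sum.inl l) + c * B i (Sum.inl l) := fun c i l => by
    rw [Matrix.map_apply]
    simp [M]
    exact mul_comm _ _
  have hMr : ∀ (c : K) i l, (M.map (Polynomial.evalRingHom c)) i (Sum.inr l) =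
      B i (Sum.inr 0) := fun c i l => by
    rw [Matrix.map_apply]
    simp [M]
  -- At parameter 0 the matrix is block with identity corner, so its determinant is the Schur
  -- complement assumed nonzero.
  have hM0 : (M.map (Polynomial.evalRingHom (0 : K))).det ≠ 0 := by
    have hblock : M.map (Polynomial.evalRingHom (0 : K)) =
        Matrix.fromBlocks (1 : Matrix (Fin m) (Fin m) K)
          (Matrix.of fun i (_ : Fin 1) => B (Sum.inl i) (Sum.inr 0))
          (Matrix.of fun (_ : Fin 1) l => A (Sum.inr 0) (Sum.inl l))
          (Matrix.of fun (_ : Fin 1) _ => B (Sum.inr 0) (Sum.inr 0)) := by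
      refine Matrix.ext fun i l => ?_
      rcases l with l | l
      · rw [hMl, zero_mul, add_zero]
        rcases i with i | i
        · rw [hA, Matrix.fromBlocks_apply₁₁, Matrix.one_apply, Pi.single_apply]
          simp only [Sum.inl.injEq, eq_comm]
        · rw [Subsingleton.elim i 0, Matrix.fromBlocks_apply₂₁, Matrix.of_apply]
      · rw [hMr]
        rcases i with i | i
        · rw [Matrix.fromBlocks_apply₁₂, Matrix.of_apply]
        · rw [Subsingleton.elim i 0, Matrix.fromBlocks_apply₂₂, Matrix.of_apply]
    rw [hblock, Matrix.det_fromBlocks_one₁₁, Matrix.det_fin_one, Matrix.sub_apply,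
      Matrix.mul_apply]
    exact hB
  have hM : M.det ≠ 0 := fun h => by
    rw [← RingHom.mapMatrix_apply, ← RingHom.map_det, h, map_zero] at hM0
    exact hM0 rfl
  -- The factor X also forces c ≠ 0, needed to restore the last column.
  obtain ⟨c, hc⟩ := exists_eval_natCast_ne_zero (mul_ne_zero Polynomial.X_ne_zero hM)
  rw [Polynomial.eval_mul, Polynomial.eval_X] at hc
  refine ⟨c, ?_⟩
  have hrows : (Matrix.of fun i => A i + (c : K) • B i) =
      M.map (Polynomial.evalRingHom (c : K)) *
        Matrix.diagonal (Sum.elim (fun _ => 1) fun _ => (c : K)) := by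
    refine Matrix.ext fun i l => ?_
    rw [Matrix.mul_diagonal, Matrix.of_apply, Pi.add_apply, Pi.smul_apply, smul_eq_mul]
    rcases l with l | l
    · rw [hMl, Sum.elim_inl, mul_one]
    · rw [hMr, Subsingleton.elim l 0, hA0, zero_add, Sum.elim_inr, mul_comm]
  change LinearIndependent K (Matrix.of fun i => A i + (c : K) • B i).row
  refine Matrix.linearIndependent_rows_of_det_ne_zero
    (A := Matrix.of fun i => A i + (c : K) • B i) ?_
  rw [hrows, Matrix.det_mul, Matrix.det_diagonal]
  refine mul_ne_zero ?_ (Finset.prod_ne_zero_iff.2 fun i _ => ?_)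
  · rw [← RingHom.mapMatrix_apply, ← RingHom.map_det]
    exact right_ne_zero_of_mul hc
  · rcases i with i | i
    · exact one_ne_zero
    · exact left_ne_zero_of_mul hc

end Polynomials

/-! ### The cyclic vector theorem -/

section CyclicVector

variable {k : Type u} [Field k]
variable {U : Type v} [AddCommGroup U] [Module k⸨X⸩ U] [Module k⟦X⟧ U]
  [IsScalarTower k⟦X⟧ k⸨X⸩ U] [Module k U] [IsScalarTower k k⸨X⸩ U]

theorem charZero_laurentSeries [CharZero k] : CharZero k⸨X⸩ :=
  charZero_of_injective_ringHom (f := (HahnSeries.C : k →+* k⸨X⸩)) HahnSeries.C_injective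

namespace Connection

variable (D : Connection k U)

/-- Conjugating `∇_τ` by z^j adds the scalar j, since τ(z^j) = j z^j. -/
theorem pow_single_smul (j i : ℕ) : ∀ u : U,
    (D.op ^ i) ((HahnSeries.single (j : ℤ) (1 : k) : k⸨X⸩) • u) =
      (HahnSeries.single (j : ℤ) (1 : k) : k⸨X⸩) •
        ((D.op + j • (1 : Module.End k U)) ^ i) u := by
  induction i with
  | zero => intro u; rfl
  | succ i ih =>
    intro u
    rw [pow_succ, pow_succ, Module.End.mul_apply, Module.End.mul_apply, ← ih]
    congr 1
    rw [D.leibniz, euler_single, LinearMap.add_apply, LinearMap.smul_apply, Module.End.one_apply,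
      smul_add, add_comm, mul_comm, mul_smul, Int.cast_natCast, Nat.cast_smul_eq_nsmul]

/-- The values `ψ((∇_τ + j)^i f)` are given by a polynomial in `j` with top coefficient `ψ(f)`. -/
theorem exists_polynomial (ψ : U →ₗ[k⸨X⸩] k⸨X⸩) (i : ℕ) : ∀ f : U,
    ∃ Q : Polynomial k⸨X⸩, Q.natDegree ≤ i ∧ Q.coeff i = ψ f ∧
      ∀ j : ℕ, ψ (((D.op + j • (1 : Module.End k U)) ^ i) f) = Q.eval (j : k⸨X⸩) := by
  induction i with
  | zero => exact fun f => ⟨Polynomial.C (ψ f), by simp, by simp, by simp⟩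
  | succ i ih =>
    intro f
    obtain ⟨P, hP, -, hPe⟩ := ih (D.op f)
    obtain ⟨Q, hQ, hQc, hQe⟩ := ih f
    refine ⟨P + Polynomial.X * Q, ?_, ?_, fun j => ?_⟩
    · refine Polynomial.natDegree_add_le_of_degree_le (hP.trans i.le_succ) ?_
      refine Polynomial.natDegree_mul_le.trans ?_
      have := Polynomial.natDegree_X_le (R := k⸨X⸩)
      omega
    · rw [Polynomial.coeff_add, Polynomial.coeff_X_mul, hQc,
        Polynomial.coeff_eq_zero_of_natDegree_lt (Nat.lt_succ_of_le hP), zero_add]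
    · rw [pow_succ, Module.End.mul_apply, LinearMap.add_apply, LinearMap.smul_apply,
        Module.End.one_apply, map_add, map_add, hPe, map_nsmul, map_nsmul, hQe,
        Polynomial.eval_add, Polynomial.eval_mul, Polynomial.eval_X, nsmul_eq_mul]

variable {D}

/-- If the span of `e, ∇_τ e, …` stops growing before it exhausts `U`, a perturbation of `e`
generates a bigger one. -/
theorem exists_linearIndependent_succ [CharZero k] {m : ℕ} {e : U}
    (hv : LinearIndependent k⸨X⸩ fun i : Fin m => (D.op ^ (i : ℕ)) e)
    (he : (D.op ^ m) e ∈ Submodule.span k⸨X⸩ (Set.range fun i : Fin m => (D.op ^ (i : ℕ)) e))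
    {f : U} (hf : f ∉ Submodule.span k⸨X⸩ (Set.range fun i : Fin m => (D.op ^ (i : ℕ)) e)) :
    ∃ g : U, LinearIndependent k⸨X⸩ fun i : Fin (m + 1) => (D.op ^ (i : ℕ)) g := by
  classical
  have := charZero_laurentSeries (k := k)
  set v : Fin m → U := fun i => (D.op ^ (i : ℕ)) e with hvdef
  set w : Fin m ⊕ Fin 1 → U := Sum.elim v fun _ => f with hw
  have hwi : LinearIndependent k⸨X⸩ w := by
    refine hv.sum_type ?_ ?_
    · exact (linearIndependent_unique_iff).2 (by rintro rfl; exact hf (zero_mem _))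
    · rw [Set.range_const, Submodule.disjoint_span_singleton']
      · exact hf
      · rintro rfl; exact hf (zero_mem _)
  obtain ⟨P, hP⟩ := (Fintype.linearCombination k⸨X⸩ w).exists_leftInverse_of_injective
    (LinearMap.ker_eq_bot.2 (linearIndependent_iff_injective_fintypeLinearCombination.1 hwi))
  have hPw : ∀ i, P (w i) = Pi.single i 1 := fun i => by
    have := LinearMap.congr_fun hP (Pi.single i 1)
    rwa [LinearMap.comp_apply, Fintype.linearCombination_apply_single, one_smul] at this
  have hPv : ∀ i, P (v i) = Pi.single (Sum.inl i) 1 := fun i => hPw (Sum.inl i)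
  -- The functional ψ detects f modulo the span of the iterates of e.
  set ψ : U →ₗ[k⸨X⸩] k⸨X⸩ := LinearMap.proj (Sum.inr 0) ∘ₗ P with hψ
  have hψv : ∀ u ∈ Submodule.span k⸨X⸩ (Set.range v), ψ u = 0 := by
    intro u hu
    induction hu using Submodule.span_induction with
    | mem _ h =>
      obtain ⟨i, rfl⟩ := h
      rw [hψ, LinearMap.comp_apply, hPv, LinearMap.proj_apply, Pi.single_eq_of_ne (by simp)]
    | zero => exact map_zero _
    | add _ _ _ _ h1 h2 => rw [map_add, h1, h2, add_zero]
    | smul c _ _ h => rw [map_smul, h, smul_zero]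
  have hψf : ψ f = 1 := by
    rw [hψ, LinearMap.comp_apply, show f = w (Sum.inr 0) from rfl, hPw, LinearMap.proj_apply,
      Pi.single_eq_same]
  choose Q hQd hQc hQe using fun i => D.exists_polynomial ψ i f
  -- choice of the exponent `j`
  obtain ⟨j, hj⟩ : ∃ j : ℕ, (Q m - ∑ l : Fin m,
      Polynomial.C (P ((D.op ^ m) e) (Sum.inl l)) * Q l).eval (j : k⸨X⸩) ≠ 0 := by
    -- The coefficient of degree m is ψ(f) = 1: the subtracted polynomials have degree at most l <
    -- m.
    refine exists_eval_natCast_ne_zero fun h0 => ?_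
    have := congrArg (Polynomial.coeff · m) h0
    simp only [Polynomial.coeff_sub, Polynomial.finsetSum_coeff, Polynomial.coeff_C_mul, hQc,
      Polynomial.coeff_zero, hψf] at this
    rw [Finset.sum_eq_zero, sub_zero] at this
    · exact one_ne_zero this
    · intro l _
      rw [Polynomial.coeff_eq_zero_of_natDegree_lt ((hQd l).trans_lt l.2), mul_zero]
  set z : k⸨X⸩ := HahnSeries.single (j : ℤ) 1 with hz
  have hz0 : z ≠ 0 := HahnSeries.single_ne_zero one_ne_zero
  set T : Module.End k U := D.op + j • (1 : Module.End k U) with hT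
  let deg : Fin m ⊕ Fin 1 → ℕ := Sum.elim (fun i => (i : ℕ)) fun _ => m
  -- The perturbed vector is e + c z^j f. The first-order condition on the Schur complement is z^j
  -- times the polynomial value just made nonzero.
  obtain ⟨c, hc⟩ := exists_natCast_linearIndependent (fun i => P ((D.op ^ deg i) e))
    (fun i => z • P ((T ^ deg i) f)) hPv
    (by
      rintro (i | i)
      · exact hψv _ (Submodule.subset_span ⟨i, rfl⟩)
      · exact hψv _ he)
    (by
      simp only [Polynomial.eval_sub, Polynomial.eval_finsetSum, Polynomial.eval_mul,
        Polynomial.eval_C, ← hQe] at hj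
      convert mul_ne_zero hz0 hj using 1
      rw [mul_sub, Finset.mul_sum]
      refine congrArg₂ _ rfl (Finset.sum_congr rfl fun l _ => ?_)
      rw [mul_left_comm]
      rfl)
  set g : U := e + c • z • f with hg
  refine ⟨g, ?_⟩
  have hind : LinearIndependent k⸨X⸩ fun i => (D.op ^ deg i) g := by
    refine LinearIndependent.of_comp P ?_
    have hcomp : (P ∘ fun i => (D.op ^ deg i) g) =
        fun i => P ((D.op ^ deg i) e) + (c : k⸨X⸩) • z • P ((T ^ deg i) f) := by
      funext i
      rw [Function.comp_apply, hg, map_add, map_nsmul, hz, pow_single_smul, map_add, map_nsmul,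
        map_smul, Nat.cast_smul_eq_nsmul]
    rw [hcomp]
    exact hc
  refine (linearIndependent_equiv finSumFinEquiv).1 ?_
  convert hind using 2 with i
  rcases i with i | i
  · rfl
  · obtain rfl : i = 0 := Subsingleton.elim _ _
    rfl

variable (D)

/-- The cyclic vector theorem. -/
theorem exists_cyclicVector [CharZero k] [FiniteDimensional k⸨X⸩ U] :
    ∃ e : U, LinearIndependent k⸨X⸩
      fun i : Fin (Module.finrank k⸨X⸩ U) => (D.op ^ (i : ℕ)) e := by
  suffices H : ∀ m ≤ Module.finrank k⸨X⸩ U, ∃ e : U, LinearIndependent k⸨X⸩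
      fun i : Fin m => (D.op ^ (i : ℕ)) e from H _ le_rfl
  intro m
  induction m with
  | zero => exact fun _ => ⟨0, linearIndependent_empty_type⟩
  | succ m ih =>
    intro hm
    obtain ⟨e, hv⟩ := ih (by omega)
    by_cases he : (D.op ^ m) e ∈
        Submodule.span k⸨X⸩ (Set.range fun i : Fin m => (D.op ^ (i : ℕ)) e)
    · obtain ⟨f, hf⟩ : ∃ f : U,
          f ∉ Submodule.span k⸨X⸩ (Set.range fun i : Fin m => (D.op ^ (i : ℕ)) e) := by
        by_contra! h
        have h1 := finrank_span_eq_card hv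
        rw [Submodule.eq_top_iff'.2 h, finrank_top, Fintype.card_fin] at h1
        omega
      exact exists_linearIndependent_succ hv he hf
    · refine ⟨e, ?_⟩
      have hsnoc : (fun i : Fin (m + 1) => (D.op ^ (i : ℕ)) e) =
          Fin.snoc (fun i : Fin m => (D.op ^ (i : ℕ)) e) ((D.op ^ m) e) := by
        ext i
        refine Fin.lastCases ?_ (fun i => ?_) i <;> simp
      rw [hsnoc]
      exact linearIndependent_finSnoc.2 ⟨hv, he⟩

end Connection

end CyclicVector

/-- A companion matrix with a nonzero lower coefficient is not nilpotent. -/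
theorem not_isNilpotent_of_cyclic {K V : Type*} [Field K] [AddCommGroup V] [Module K V]
    {E : Module.End K V} {n : ℕ} {v : V} (hv : ∀ i < n, (E ^ i) v ≠ 0) {d : Fin n → K}
    (hd : d ≠ 0) (hE : (E ^ n) v = ∑ i : Fin n, d i • (E ^ (i : ℕ)) v) : ¬ IsNilpotent E := by
  classical
  rintro ⟨N, hN⟩
  have hex : ∃ q, (E ^ q) v = 0 := ⟨N, by rw [hN, LinearMap.zero_apply]⟩
  obtain ⟨q, hq0, hqmin⟩ : ∃ q, (E ^ q) v = 0 ∧ ∀ i < q, (E ^ i) v ≠ 0 :=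
    ⟨Nat.find hex, Nat.find_spec hex, fun i hi => Nat.find_min hex hi⟩
  have hzero : ∀ i, q ≤ i → (E ^ i) v = 0 := fun i hi => by
    obtain ⟨l, rfl⟩ := Nat.exists_eq_add_of_le' hi
    rw [pow_add, Module.End.mul_apply, hq0, map_zero]
  have hnq : n ≤ q := not_lt.1 fun h => hv q h hq0
  obtain ⟨p, hp, hpmin⟩ : ∃ p : Fin n, d p ≠ 0 ∧ ∀ i < p, d i = 0 := by
    obtain ⟨i, hi⟩ := Function.ne_iff.1 hd
    obtain ⟨p, hp, hpm⟩ := (Finset.univ.filter fun i => d i ≠ 0).exists_minimal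
      ⟨i, by simpa using hi⟩
    refine ⟨p, (Finset.mem_filter.1 hp).2, fun i hi => ?_⟩
    by_contra h
    exact absurd (hpm (Finset.mem_filter.2 ⟨Finset.mem_univ _, h⟩) hi.le) (not_le.2 hi)
  have hpn := p.2
  -- With p the first nonzero coefficient and q the first vanishing iterate, this power leaves only
  -- d_p E^{q-1} v on the right, while the left side has exponent at least q.
  have h := congrArg (E ^ (q - 1 - p)) hE
  rw [← Module.End.mul_apply, ← pow_add, hzero _ (by omega), map_sum,
    Finset.sum_eq_single p] at h
  · rw [map_smul, ← Module.End.mul_apply, ← pow_add, eq_comm, smul_eq_zero] at h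
    exact h.elim hp (hqmin _ (by omega))
  · intro i _ hip
    rcases lt_or_gt_of_ne hip with hi | hi
    · rw [hpmin i hi, zero_smul, map_zero]
    · have hi' : (p : ℕ) < i := hi
      rw [map_smul, ← Module.End.mul_apply, ← pow_add, hzero _ (by omega), smul_zero]
  · simp

theorem degreePart_zero_right {k : Type u} [Field k] (c : ℝ) : degreePart c (0 : k⸨X⸩) = 0 := by
  rw [degreePart]
  split_ifs <;> simp

theorem degreePart_zero_one {k : Type u} [Field k] : degreePart 0 (1 : k⸨X⸩) = 1 := by
  simp [degreePart]

/-! ### A point of the building that computes the slope -/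

section Existence

variable {k : Type u} [Field k]
variable {U : Type v} [AddCommGroup U] [Module k⸨X⸩ U] [Module k⟦X⟧ U]
  [IsScalarTower k⟦X⟧ k⸨X⸩ U] [Module k U] [IsScalarTower k k⸨X⸩ U]

namespace Connection

variable {D : Connection k U}

section Cyclic

variable {b : Module.Basis (Fin (Module.finrank k⸨X⸩ U)) k⸨X⸩ U} {e : U}
  (hb : ∀ i, b i = (D.op ^ (i : ℕ)) e)
include hb

theorem op_cyclicBasis (j : Fin (Module.finrank k⸨X⸩ U)) (h : (j : ℕ) + 1 < Module.finrank k⸨X⸩ U) :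
    D.op (b j) = b ⟨j + 1, h⟩ := by
  rw [hb, hb, pow_succ', Module.End.mul_apply]

theorem op_cyclicBasis_last (j : Fin (Module.finrank k⸨X⸩ U))
    (h : (j : ℕ) + 1 = Module.finrank k⸨X⸩ U) :
    D.op (b j) = (D.op ^ Module.finrank k⸨X⸩ U) e := by
  rw [hb, ← Module.End.mul_apply, ← pow_succ', h]

/-- Each shift `∇_τ^i e` ↦ `∇_τ^{i+1} e` lowers the degree by exactly s; the condition on
coefficients says that the last column loses no more. -/
theorem lowersBy_cyclicBasis {s : ℝ} (hs : 0 ≤ s)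
    (hc : ∀ i : Fin (Module.finrank k⸨X⸩ U),
      VanishBelow (b.repr ((D.op ^ Module.finrank k⸨X⸩ U) e) i)
        (-(s * ((Module.finrank k⸨X⸩ U : ℝ) - (i : ℕ))))) :
    D.LowersBy (BuildingPoint.ofBasis b fun i => -(s * (i : ℕ))) s := by
  have had := BuildingPoint.ofBasis_isAdapted b fun i => -(s * (i : ℕ))
  refine D.lowersBy_of_basis had hs fun j => ?_
  rcases (Nat.succ_le_of_lt j.2).lt_or_eq with h | h
  · rw [op_cyclicBasis hb j h]
    refine BuildingPoint.filt_antitone _ ?_ (had.basis_mem _)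
    push_cast
    linarith
  · rw [op_cyclicBasis_last hb j h, had]
    refine fun i => (hc i).mono ?_
    have h' : (Module.finrank k⸨X⸩ U : ℝ) = (j : ℕ) + 1 := by exact_mod_cast h.symm
    rw [h']
    linarith

/-- The leading part is again a companion matrix, whose last column keeps the terms of `∇_τ^n e` on
the Newton edge of slope s; the hypothesis provides one that is nonzero. -/
theorem leadingPart_cyclicBasis_not_isNilpotent {s : ℝ}
    {i : Fin (Module.finrank k⸨X⸩ U)} {m : ℤ}
    (hm : (m : ℝ) = -(s * ((Module.finrank k⸨X⸩ U : ℝ) - (i : ℕ))))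
    (hi : (b.repr ((D.op ^ Module.finrank k⸨X⸩ U) e) i).coeff m ≠ 0) :
    ¬ IsNilpotent (D.leadingPart b (fun i => -(s * (i : ℕ))) s) := by
  set E := D.leadingPart b (fun i => -(s * (i : ℕ))) s with hE
  have hn0 : 0 < Module.finrank k⸨X⸩ U := i.pos
  have hnext : ∀ (j : Fin (Module.finrank k⸨X⸩ U)) (h : (j : ℕ) + 1 < Module.finrank k⸨X⸩ U), E (b j) = b ⟨j + 1, h⟩ := by
    intro j h
    refine b.ext_elem fun l => ?_
    rw [hE, repr_leadingPart, op_cyclicBasis hb j h, b.repr_self]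
    rcases eq_or_ne l ⟨j + 1, h⟩ with rfl | hl
    · rw [Finsupp.single_eq_same, show -(s * ((j : ℕ) : ℝ)) - s -
        -(s * (((⟨(j : ℕ) + 1, h⟩ : Fin (Module.finrank k⸨X⸩ U)) : ℕ) : ℝ)) = 0 by push_cast; ring, degreePart_zero_one]
    · rw [Finsupp.single_eq_of_ne hl, degreePart_zero_right]
  have hpow : ∀ (l : ℕ) (h : l < Module.finrank k⸨X⸩ U), (E ^ l) (b ⟨0, hn0⟩) = b ⟨l, h⟩ := by
    intro l
    induction l with
    | zero => exact fun _ => rfl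
    | succ l ih =>
      intro h
      rw [pow_succ', Module.End.mul_apply, ih (by omega), hnext]
  refine not_isNilpotent_of_cyclic (n := Module.finrank k⸨X⸩ U) (v := b ⟨0, hn0⟩)
    (d := fun l => degreePart (-(s * ((Module.finrank k⸨X⸩ U : ℝ) - (l : ℕ)))) (b.repr ((D.op ^ (Module.finrank k⸨X⸩ U)) e) l)) ?_ ?_ ?_
  · intro l hl
    rw [hpow l hl]
    exact b.ne_zero _
  · intro h0
    have := congrFun h0 i
    refine hi ?_
    rw [← degreePart_coeff_of_eq hm, this]
    rfl
  · have hlast : Module.finrank k⸨X⸩ U - 1 + 1 = Module.finrank k⸨X⸩ U := by omega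
    have h1 : (E ^ (Module.finrank k⸨X⸩ U)) (b ⟨0, hn0⟩) = E (b ⟨Module.finrank k⸨X⸩ U - 1, by omega⟩) := by
      have h2 := pow_succ' E (Module.finrank k⸨X⸩ U - 1)
      rw [hlast] at h2
      rw [h2, Module.End.mul_apply, hpow _ (by omega)]
    rw [h1]
    refine b.ext_elem fun l => ?_
    simp only [hpow _ (Fin.is_lt _), Fin.eta]
    rw [hE, repr_leadingPart, op_cyclicBasis_last hb _ hlast, b.repr_sum_self]
    congr 1
    have : ((Module.finrank k⸨X⸩ U - 1 : ℕ) : ℝ) = Module.finrank k⸨X⸩ U - 1 := by rw [Nat.cast_sub hn0, Nat.cast_one]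
    rw [this]
    ring

end Cyclic

variable (D)

/-- Some point of the building computes the slope: either `∇_τ` preserves its filtration, or the
leading part of `∇_τ` at this point is not nilpotent. -/
theorem exists_lowersBy [CharZero k] [FiniteDimensional k⸨X⸩ U] :
    ∃ (s : ℚ) (x : BuildingPoint k U) (b : Module.Basis (Fin (Module.finrank k⸨X⸩ U)) k⸨X⸩ U)
      (a : Fin (Module.finrank k⸨X⸩ U) → ℝ), x.IsAdapted b a ∧ D.LowersBy x (s : ℝ) ∧
        (s = 0 ∨ 0 < s ∧ ¬ IsNilpotent (D.leadingPart b a (s : ℝ))) := by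
  classical
  obtain ⟨e, he⟩ := D.exists_cyclicVector
  set n := Module.finrank k⸨X⸩ U with hn
  let b : Module.Basis (Fin n) k⸨X⸩ U := Module.Basis.mk he
    (he.span_eq_top_of_card_eq_finrank' (by simp [hn])).ge
  have hb : ∀ i, b i = (D.op ^ (i : ℕ)) e := fun i => Module.Basis.mk_apply _ _ i
  set c := b.repr ((D.op ^ n) e) with hc
  have hpos : ∀ i : Fin n, (0 : ℚ) < n - (i : ℕ) := fun i => sub_pos.2 (by exact_mod_cast i.2)
  -- The slope of the Newton polygon segment defined by the i-th coefficient: the s for which this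
  -- coefficient sits exactly in the critical degree -s(n - i).
  let slope : Fin n → ℚ := fun i => -(c i).order / (n - (i : ℕ))
  have hslope : ∀ i, ((c i).order : ℝ) = -((slope i : ℚ) * ((n : ℝ) - (i : ℕ))) := by
    intro i
    have h : ((c i).order : ℚ) = -(slope i * ((n : ℚ) - (i : ℕ))) := by
      rw [div_mul_cancel₀ _ (hpos i).ne', neg_neg]
    exact_mod_cast congrArg (Rat.cast : ℚ → ℝ) h
  have hbelow : ∀ s : ℚ, (∀ i, c i ≠ 0 → slope i ≤ s) → ∀ i,
      VanishBelow (c i) (-((s : ℝ) * ((n : ℝ) - (i : ℕ)))) := by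
    intro s hs i
    by_cases h0 : c i = 0
    · rw [h0]
      exact VanishBelow.zero _
    · intro m hm
      refine HahnSeries.coeff_eq_zero_of_lt_order ?_
      have h1 : ((slope i : ℚ) : ℝ) * ((n : ℝ) - (i : ℕ)) ≤ s * ((n : ℝ) - (i : ℕ)) :=
        mul_le_mul_of_nonneg_right (by exact_mod_cast hs i h0)
          (by exact_mod_cast (hpos i).le)
      have h2 : (m : ℝ) < (c i).order := by
        rw [hslope]
        linarith
      exact_mod_cast h2
  by_cases hreg : ∀ i, c i ≠ 0 → slope i ≤ 0
  · refine ⟨0, _, b, fun i => -(((0 : ℚ) : ℝ) * (i : ℕ)), BuildingPoint.ofBasis_isAdapted b _, ?_, Or.inl rfl⟩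
    · exact lowersBy_cyclicBasis hb (by simp) (hbelow 0 hreg)
  · push Not at hreg
    obtain ⟨i₀, hi₀, hs₀⟩ := hreg
    obtain ⟨i, hi, hmax⟩ := (Finset.univ.filter fun i => c i ≠ 0).exists_max_image slope
      ⟨i₀, by simpa using hi₀⟩
    have hmax' : ∀ l, c l ≠ 0 → slope l ≤ slope i := fun l hl =>
      hmax l (Finset.mem_filter.2 ⟨Finset.mem_univ _, hl⟩)
    have hspos : 0 < slope i := hs₀.trans_le (hmax' i₀ hi₀)
    refine ⟨slope i, _, b, fun l => -((slope i : ℝ) * (l : ℕ)),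
      BuildingPoint.ofBasis_isAdapted b _, ?_, Or.inr ⟨hspos, ?_⟩⟩
    · exact lowersBy_cyclicBasis hb (by exact_mod_cast hspos.le) (hbelow _ hmax')
    · exact leadingPart_cyclicBasis_not_isNilpotent hb (hslope i)
        (HahnSeries.coeff_order_eq_zero.not.2 (Finset.mem_filter.1 hi).2)

end Connection

end Existence

/-! ### Lattices as steps of filtrations -/

section Lattices

variable {k : Type u} [Field k]
variable {U : Type v} [AddCommGroup U] [Module k⸨X⸩ U] [Module k⟦X⟧ U]
  [IsScalarTower k⟦X⟧ k⸨X⸩ U] [Module k U] [IsScalarTower k k⸨X⸩ U]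

/-- Every lattice occurs in the filtration of a point of the building. -/
theorem exists_point_of_isLattice [FiniteDimensional k⸨X⸩ U] (L : Submodule k⟦X⟧ U)
    (hL : L.IsLattice k⸨X⸩) :
    ∃ (x : BuildingPoint k U) (b : Module.Basis (Fin (Module.finrank k⸨X⸩ U)) k⸨X⸩ U),
      x.IsAdapted b 0 ∧ x.filt 0 = L := by
  let b₀ := Module.Free.chooseBasis k⟦X⟧ L
  let ε : Module.Free.ChooseBasisIndex k⟦X⟧ L ≃ Fin (Module.finrank k⸨X⸩ U) :=
    Fintype.equivFinOfCardEq (Module.finrank_eq_card_basis (b₀.extendOfIsLattice k⸨X⸩)).symm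
  let b := (b₀.extendOfIsLattice k⸨X⸩).reindex ε
  have hb : ∀ i, b i = (b₀ (ε.symm i) : U) := fun i => by
    rw [Module.Basis.reindex_apply, Module.Basis.extendOfIsLattice_apply]
  have h := BuildingPoint.ofBasis_isAdapted b 0
  refine ⟨BuildingPoint.ofBasis b 0, b, h, le_antisymm (fun u hu => ?_) fun u hu => ?_⟩
  · rw [← b.sum_repr u]
    refine sum_mem fun i _ => ?_
    obtain ⟨g, hg⟩ := (((h _ _).1 hu i).mono (d := 0) (by simp)).exists_powerSeries
    rw [← hg, algebraMap_smul, hb]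
    exact L.smul_mem _ (b₀ _).2
  · have hu' : u = ∑ i, b₀.repr ⟨u, hu⟩ i • (b₀ i : U) := by
      have := congrArg Subtype.val (b₀.sum_repr ⟨u, hu⟩)
      rw [Submodule.coe_sum] at this
      exact this.symm
    rw [hu']
    refine sum_mem fun i _ => Submodule.smul_mem _ _ ?_
    have := h.basis_mem (ε i)
    rwa [hb, Equiv.symm_apply_apply] at this

theorem BuildingPoint.isLattice_filt [FiniteDimensional k⸨X⸩ U] (x : BuildingPoint k U) (t : ℝ) :
    (x.filt t).IsLattice k⸨X⸩ := by
  obtain ⟨b, a, h⟩ := x.exists_isAdapted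
  have hmem : ∀ i, (HahnSeries.single ⌈t - a i⌉ (1 : k) : k⸨X⸩) • b i ∈ x.filt t := fun i =>
    x.filt_antitone (by linarith [Int.le_ceil (t - a i)])
      (x.smul_mem_filt_add (VanishBelow.single _ _) (h.basis_mem i))
  have hinv : ∀ i, b i = (HahnSeries.single (-⌈t - a i⌉) (1 : k) : k⸨X⸩) •
      (HahnSeries.single ⌈t - a i⌉ (1 : k) : k⸨X⸩) • b i := fun i => by
    rw [smul_smul, HahnSeries.single_mul_single, neg_add_cancel, mul_one,
      HahnSeries.single_zero_one, one_smul]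
  constructor
  · have hspan : x.filt t = Submodule.span k⟦X⟧ (Set.range fun i =>
        (HahnSeries.single ⌈t - a i⌉ (1 : k) : k⸨X⸩) • b i) := by
      refine le_antisymm (fun u hu => ?_) (Submodule.span_le.2 ?_)
      · rw [← b.sum_repr u]
        refine sum_mem fun i _ => ?_
        have hv : VanishBelow (b.repr u i) (⌈t - a i⌉ : ℤ) := fun m hm =>
          (h _ _).1 hu i m (Int.lt_ceil.1 (by exact_mod_cast hm))
        obtain ⟨g, hg⟩ := ((hv.mul (VanishBelow.single (-⌈t - a i⌉) (1 : k))).mono (d := 0)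
          (by simp)).exists_powerSeries
        rw [hinv i, smul_smul, ← hg, algebraMap_smul]
        exact Submodule.smul_mem _ _ (Submodule.subset_span ⟨i, rfl⟩)
      · rintro _ ⟨i, rfl⟩
        exact hmem i
    rw [hspan]
    exact Submodule.fg_span (Set.finite_range _)
  · rw [eq_top_iff, ← b.span_eq, Submodule.span_le]
    rintro _ ⟨i, rfl⟩
    rw [hinv i]
    exact Submodule.smul_mem _ _ (Submodule.subset_span (hmem i))

theorem Connection.isRegularSingular_iff [FiniteDimensional k⸨X⸩ U] (D : Connection k U) :
    D.IsRegularSingular ↔ ∃ x : BuildingPoint k U, D.LowersBy x 0 := by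
  constructor
  · rintro ⟨L, hL, hD⟩
    obtain ⟨x, b, h, rfl⟩ := exists_point_of_isLattice L hL
    refine ⟨x, D.lowersBy_of_basis h le_rfl fun j => ?_⟩
    rw [Pi.zero_apply, sub_zero]
    exact hD _ (by simpa using h.basis_mem j)
  · rintro ⟨x, hx⟩
    exact ⟨x.filt 0, x.isLattice_filt 0, fun u hu => by simpa using hx 0 u hu⟩

theorem inShiftedLattice_iff {ι : Type*} (x : BuildingPoint k U) (m : ℤ) (e : ι → U) :
    InShiftedLattice (x.filt 0) m e ↔ ∀ j, e j ∈ x.filt (m : ℝ) := by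
  refine forall_congr' fun j => ⟨?_, fun h => ?_⟩
  · rintro ⟨w, hw, h⟩
    rw [h]
    simpa using (x.single_smul_mem_filt m).2 hw
  · refine ⟨(HahnSeries.single (-m) (1 : k) : k⸨X⸩) • e j, ?_, ?_⟩
    · have := (x.single_smul_mem_filt (-m)).2 h
      simpa using this
    · rw [smul_smul, HahnSeries.single_mul_single, add_neg_cancel, mul_one,
        HahnSeries.single_zero_one, one_smul]

end Lattices

/-! ### Comparison of growth rates and the slope -/

namespace Connection

section Slope

variable {k : Type u} [Field k]
variable {U : Type v} [AddCommGroup U] [Module k⸨X⸩ U] [Module k⟦X⟧ U]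
  [IsScalarTower k⟦X⟧ k⸨X⸩ U] [Module k U] [IsScalarTower k k⸨X⸩ U]

variable {D : Connection k U}

theorem le_of_growth {ι : Type*} {y : BuildingPoint k U} {e : ι → U} {r r' C C' : ℝ}
    (hlow : ∀ (i : ℕ) (j : ι), (D.op ^ i) (e j) ∈ y.filt (-(r' * i) - C'))
    (hup : ∀ i : ℕ, ∃ j, (D.op ^ i) (e j) ∉ y.filt (-(r * i) + C)) : r ≤ r' := by
  by_contra! h
  obtain ⟨i, hi⟩ := exists_nat_gt ((C + C') / (r - r'))
  rw [div_lt_iff₀ (sub_pos.2 h)] at hi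
  obtain ⟨j, hj⟩ := hup i
  exact hj (y.filt_antitone (by linarith) (hlow i j))

section

variable {x : BuildingPoint k U} {b : Module.Basis (Fin (Module.finrank k⸨X⸩ U)) k⸨X⸩ U}
  {a : Fin (Module.finrank k⸨X⸩ U) → ℝ} {r : ℝ} (hD : D.LowersBy x r) (h : x.IsAdapted b a)
  (hr : 0 < r) (hnil : ¬ IsNilpotent (D.leadingPart b a r))
include hD h hr hnil

/-- A point with non-nilpotent leading part minimizes the amount by which `∇_τ` lowers degrees. -/
theorem LowersBy.le_of_not_isNilpotent {y : BuildingPoint k U} {r' : ℝ} (hy : D.LowersBy y r') :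
    r ≤ r' := by
  obtain ⟨C, hC⟩ := hD.exists_forall_pow_notMem h hr hnil x b
  obtain ⟨C', hC'⟩ := hy.exists_forall_pow_mem x b
  exact le_of_growth hC' hC

/-- A nilpotent leading part at y would give growth at a rate below r, against the upper bound
obtained at x. -/
theorem LowersBy.not_isNilpotent_of_eq {y : BuildingPoint k U}
    {b' : Module.Basis (Fin (Module.finrank k⸨X⸩ U)) k⸨X⸩ U}
    {a' : Fin (Module.finrank k⸨X⸩ U) → ℝ} (hy : D.LowersBy y r) (h' : y.IsAdapted b' a') :
    ¬ IsNilpotent (D.leadingPart b' a' r) := by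
  intro hnil'
  obtain ⟨C, hC⟩ := hD.exists_forall_pow_notMem h hr hnil x b
  obtain ⟨r', hr', C', hC'⟩ := hy.exists_lt_forall_pow_mem h' hr hnil' x b
  exact absurd (le_of_growth hC' hC) (not_le.2 hr')

theorem LowersBy.not_isRegularSingular [FiniteDimensional k⸨X⸩ U] : ¬ D.IsRegularSingular := by
  rw [isRegularSingular_iff]
  rintro ⟨y, hy⟩
  exact absurd (hD.le_of_not_isNilpotent h hr hnil hy) (not_le.2 hr)

theorem LowersBy.exists_isGreatest [FiniteDimensional k⸨X⸩ U] {L : Submodule k⟦X⟧ U}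
    (hL : L.IsLattice k⸨X⸩) (e : Module.Basis (Fin (Module.finrank k⸨X⸩ U)) k⸨X⸩ U) :
    ∃ C : ℝ, ∀ i : ℕ, ∃ m : ℤ,
      IsGreatest {m : ℤ | InShiftedLattice L m (fun j => (D.op ^ i) (e j))} m ∧
        |(m : ℝ) + r * i| ≤ C := by
  obtain ⟨y, -, -, rfl⟩ := exists_point_of_isLattice L hL
  obtain ⟨C, hC⟩ := hD.exists_forall_pow_notMem h hr hnil y e
  obtain ⟨C', hC'⟩ := hD.exists_forall_pow_mem y e
  -- The 1 absorbs the floor in the lower bound for v.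
  refine ⟨max C (C' + 1), fun i => ?_⟩
  have hup : ∀ m : ℤ, InShiftedLattice (y.filt 0) m (fun j => (D.op ^ i) (e j)) →
      (m : ℝ) < -(r * i) + C := by
    intro m hm
    by_contra! hle
    obtain ⟨j, hj⟩ := hC i
    exact hj (y.filt_antitone hle ((inShiftedLattice_iff y m _).1 hm j))
  have hlow : InShiftedLattice (y.filt 0) ⌊-(r * i) - C'⌋ (fun j => (D.op ^ i) (e j)) :=
    (inShiftedLattice_iff y _ _).2 fun j => y.filt_antitone (Int.floor_le _) (hC' i j)
  obtain ⟨m, hm, hmax⟩ := Int.exists_greatest_of_bdd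
    (P := fun m => InShiftedLattice (y.filt 0) m (fun j => (D.op ^ i) (e j)))
    ⟨⌈-(r * i) + C⌉, fun m hm => by exact_mod_cast (hup m hm).le.trans (Int.le_ceil _)⟩ ⟨_, hlow⟩
  refine ⟨m, ⟨hm, hmax⟩, abs_le.2 ⟨?_, ?_⟩⟩
  · have h1 : ((⌊-(r * i) - C'⌋ : ℤ) : ℝ) ≤ m := by exact_mod_cast hmax _ hlow
    linarith [Int.lt_floor_add_one (-(r * i) - C'), le_max_right C (C' + 1)]
  · linarith [hup m hm, le_max_left C (C' + 1)]

end

/-- A point with non-nilpotent leading part computes the slope. -/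
theorem LowersBy.hasSlope_iff [FiniteDimensional k⸨X⸩ U] {x : BuildingPoint k U}
    {b : Module.Basis (Fin (Module.finrank k⸨X⸩ U)) k⸨X⸩ U}
    {a : Fin (Module.finrank k⸨X⸩ U) → ℝ} {s : ℚ} (hD : D.LowersBy x (s : ℝ))
    (h : x.IsAdapted b a) (hs : 0 < s) (hnil : ¬ IsNilpotent (D.leadingPart b a (s : ℝ)))
    {L : Submodule k⟦X⟧ U} (hL : L.IsLattice k⸨X⸩)
    (e : Module.Basis (Fin (Module.finrank k⸨X⸩ U)) k⸨X⸩ U) (t : ℚ) :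
    D.HasSlope L e t ↔ t = s := by
  have hs' : (0 : ℝ) < s := by exact_mod_cast hs
  have hreg := hD.not_isRegularSingular h hs' hnil
  obtain ⟨C, hC⟩ := hD.exists_isGreatest h hs' hnil hL e
  constructor
  · rintro (⟨hreg', -⟩ | ⟨-, -, C', hC'⟩)
    · exact absurd hreg' hreg
    by_contra hts
    have hts' : (0 : ℝ) < |(t : ℝ) - s| := abs_pos.2 (sub_ne_zero.2 (by exact_mod_cast hts))
    -- Two rates with the same v differ by |t - s| i, which must stay bounded. The index i + 1 is
    -- used below because the definition of slope only speaks of positive iterates.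
    obtain ⟨i, hi⟩ := exists_nat_gt ((C + C') / |(t : ℝ) - s|)
    rw [div_lt_iff₀ hts'] at hi
    obtain ⟨m, hm, hmC⟩ := hC (i + 1)
    obtain ⟨m', hm', hmC'⟩ := hC' (i + 1) i.succ_pos
    obtain rfl := hm.unique hm'
    have h1 : |(m : ℝ) + t * (i + 1 : ℕ)| ≤ C' := by exact_mod_cast hmC'
    have h2 : |((t : ℝ) - s) * (i + 1 : ℕ)| ≤ C' + C := by
      rw [show ((t : ℝ) - s) * (i + 1 : ℕ) = (m + t * (i + 1 : ℕ)) - (m + s * (i + 1 : ℕ)) by ring]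
      exact (abs_sub _ _).trans (add_le_add h1 hmC)
    rw [abs_mul, Nat.abs_cast] at h2
    push_cast at h2
    linarith
  · rintro rfl
    obtain ⟨C', hCC'⟩ := exists_rat_gt C
    refine Or.inr ⟨hreg, hs, C', fun i _ => ?_⟩
    obtain ⟨m, hm, hmC⟩ := hC i
    refine ⟨m, hm, ?_⟩
    have := hmC.trans hCC'.le
    exact_mod_cast this

end Slope

end Connection

end FormalConnection

end

/-! ### The proposition -/

theorem mainTheorem5 {k : Type u} [Field k] [IsAlgClosed k] [Algebra ℝ k]
    {U : Type v} [AddCommGroup U] [Module k⸨X⸩ U] [FiniteDimensional k⸨X⸩ U]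
    [Module k⟦X⟧ U] [IsScalarTower k⟦X⟧ k⸨X⸩ U] [Module k U] [IsScalarTower k k⸨X⸩ U]
    (D : FormalConnection.Connection k U) :
    ∃ s : ℚ,
      (∀ L : Submodule k⟦X⟧ U, L.IsLattice k⸨X⸩ →
        ∀ e : Module.Basis (Fin (Module.finrank k⸨X⸩ U)) k⸨X⸩ U,
        ∀ t : ℚ, D.HasSlope L e t ↔ t = s) ∧
      IsLeast {r : ℝ | ∃ S : FormalConnection.Stratum k U, D.Contains S ∧ S.depth = r} (s : ℝ) ∧
      (∀ S : FormalConnection.Stratum k U, D.Contains S → S.IsFundamental → S.depth = (s : ℝ)) ∧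
      (∀ S : FormalConnection.Stratum k U, D.Contains S → 0 < S.depth → S.depth = (s : ℝ) →
        S.IsFundamental) ∧
      (D.IsRegularSingular ↔ ∃ S : FormalConnection.Stratum k U, D.Contains S ∧ S.depth = 0) := by
  have : CharZero k := charZero_of_injective_algebraMap (algebraMap ℝ k).injective
  obtain ⟨s, x, b, a, h, hD, hs⟩ := D.exists_lowersBy
  have hs0 : 0 ≤ s := hs.elim (fun h => h.ge) fun h => h.1.le
  have hmin : ∀ S : FormalConnection.Stratum k U, D.Contains S → (s : ℝ) ≤ S.depth := by
    intro S hS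
    rcases hs with rfl | ⟨hpos, hnil⟩
    · simpa using S.depth_nonneg
    · exact hD.le_of_not_isNilpotent h (by exact_mod_cast hpos) hnil hS.lowersBy
  have hreg : D.IsRegularSingular ↔ s = 0 := by
    refine ⟨fun hr => ?_, fun h0 => ?_⟩
    · exact hs.resolve_right fun ⟨hpos, hnil⟩ =>
        hD.not_isRegularSingular h (by exact_mod_cast hpos) hnil hr
    · subst h0
      exact D.isRegularSingular_iff.2 ⟨x, by simpa using hD⟩
  have hmem : ∃ S : FormalConnection.Stratum k U, D.Contains S ∧ S.depth = s :=
    hD.exists_contains (by exact_mod_cast hs0)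
  refine ⟨s, fun L hL e t => ?_, ⟨hmem, ?_⟩, fun S hS hf => ?_, fun S hS hpos hdepth => ?_, ?_⟩
  · rcases hs with rfl | ⟨hpos, hnil⟩
    · simp [FormalConnection.Connection.HasSlope, hreg]
    · exact hD.hasSlope_iff h hpos hnil hL e t
  · rintro _ ⟨S, hS, rfl⟩
    exact hmin S hS
  · refine le_antisymm ?_ (hmin S hS)
    rcases S.depth_nonneg.eq_or_lt with h0 | hpos
    · rw [← h0]
      exact_mod_cast hs0
    · obtain ⟨b', a', h'⟩ := S.point.exists_isAdapted
      -- The roles are exchanged: the fundamental stratum now supplies the minimizing point, to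
      -- which x is compared.
      exact hS.lowersBy.le_of_not_isNilpotent h' hpos ((hS.isFundamental_iff hpos h').1 hf) hD
  · obtain ⟨b', a', h'⟩ := S.point.exists_isAdapted
    rw [hS.isFundamental_iff hpos h']
    have hlow := hS.lowersBy
    rw [hdepth] at hpos hlow ⊢
    rcases hs with rfl | ⟨-, hnil⟩
    · simp at hpos
    · exact hD.not_isNilpotent_of_eq h hpos hnil hlow h'
  · rw [hreg]
    constructor
    · rintro rfl
      simpa using hmem
    · rintro ⟨S, hS, h0⟩
      refine le_antisymm ?_ hs0
      exact_mod_cast h0 ▸ hmin S hS
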